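/- Let $\theta\in(0,1)$ be irrational with $\theta^2=1/m$ for some positive integer $m$ that is not a perfect square. Define $T_\theta:[0,\theta]\to[0,\theta]$ by $T_\theta(0)=0$ and $$T_\theta(x)=\frac1x-\theta\left\lfloor\frac{1}{\theta x}\right\rfloor\qquad(0<x\le\theta).$$ If $T_\theta^{n}(x)\neq0$ for all $n\ge0$, we say that $x\in[0,\theta]$ has an infinite $\theta$-expansion; its digits are then the positive integers $$\ell_n(x)=\left\lfloor\frac{1}{\theta\,T_\theta^{n-1}(x)}\right\rfloor\qquad(n\ge1).$$ Put $S_{n,\theta}(x)=\sum_{k=1}^n\ell_k(x)$ and $L_{n,\theta}(x)=\max_{1\le k\le n}\ell_k(x)$. Then for every real $\alpha\ge0$ the set $$E_\theta(\alpha)=\left\{x\in[0,\theta]\setminus\mathbb{Q}:\ x\text{ has an infinite }\theta\text{-expansion and }\lim_{n\to\infty}\frac{L_{n,\theta}(x)\,\log n\,\log\log n}{S_{n,\theta}(x)-L_{n,\theta}(x)}=\alpha\right\}$$ has Hausdorff dimension $1$. -/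

import Mathlib

namespace ThetaExpansion

/-- The generalized Gauss map `T_θ` (used on `[0, θ]`):
`T_θ 0 = 0` and `T_θ x = 1/x - θ ⌊1/(θ x)⌋` for `x ≠ 0`. -/
noncomputable def gaussMap (θ x : ℝ) : ℝ :=
  if x = 0 then 0 else 1 / x - θ * (⌊1 / (θ * x)⌋ : ℝ)

/-- The θ-expansion of `x` is infinite: the orbit of `x` under `T_θ` never reaches `0`. Equivalently,
no digit of `x` is `+∞` under the convention that the digits of `0` are `+∞`. -/
def HasInfiniteExpansion (θ x : ℝ) : Prop :=
  ∀ n : ℕ, (gaussMap θ)^[n] x ≠ 0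

/-- The `n`-th digit `ℓ_n(x) = ⌊1 / (θ T_θ^{n-1}(x))⌋`, for `n ≥ 1`. It is meaningful when
`T_θ^{n-1}(x) ≠ 0`, and is only used for points with an infinite expansion. -/
noncomputable def digit (θ x : ℝ) (n : ℕ) : ℕ :=
  ⌊1 / (θ * (gaussMap θ)^[n - 1] x)⌋₊

/-- `S_{n,θ}(x)`, the sum of the first `n` digits. -/
noncomputable def digitSum (θ x : ℝ) (n : ℕ) : ℕ :=
  ∑ k ∈ Finset.Icc 1 n, digit θ x k

/-- `L_{n,θ}(x)`, the maximum of the first `n` digits. -/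
noncomputable def digitMax (θ x : ℝ) (n : ℕ) : ℕ :=
  (Finset.Icc 1 n).sup (digit θ x)

/-- The level set `E_θ(α)`. -/
def levelSet (θ α : ℝ) : Set ℝ :=
  {x | x ∈ Set.Icc 0 θ ∧ Irrational x ∧ HasInfiniteExpansion θ x ∧
    Filter.Tendsto
      (fun n : ℕ => (digitMax θ x n : ℝ) * Real.log n * Real.log (Real.log n) /
        ((digitSum θ x n : ℝ) - (digitMax θ x n : ℝ)))
      Filter.atTop (nhds α)}

end ThetaExpansion

namespace ThetaExpansion

open Filter Topology

/-- The standing assumptions on the parameter: `0 < θ < 1` and `m θ² = 1`. -/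
structure Param (θ : ℝ) (m : ℕ) : Prop where
  pos : 0 < θ
  lt_one : θ < 1
  mul_sq : (m : ℝ) * θ ^ 2 = 1

namespace Param

variable {θ : ℝ} {m : ℕ}

theorem inv_eq (h : Param θ m) : (m : ℝ) * θ = θ⁻¹ := by
  have := h.pos.ne'
  have h2 := h.mul_sq
  field_simp
  linarith

theorem one_lt_inv (h : Param θ m) : 1 < θ⁻¹ := (one_lt_inv₀ h.pos).2 h.lt_one

theorem inv_le_mul (h : Param θ m) {d : ℕ} (hd : m ≤ d) : θ⁻¹ ≤ d * θ := by
  rw [← h.inv_eq]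
  have := h.pos
  gcongr

theorem one_le_mul (h : Param θ m) {d : ℕ} (hd : m ≤ d) : 1 ≤ d * θ :=
  h.one_lt_inv.le.trans (h.inv_le_mul hd)

/-- Inverse branches map `[0, ∞)` into `[0, θ]`. -/
theorem branch_le (h : Param θ m) {d : ℕ} (hd : m ≤ d) {t : ℝ} (ht : 0 ≤ t) :
    1 / (d * θ + t) ≤ θ := by
  have h1 := h.inv_le_mul hd
  have h2 : 0 < θ⁻¹ := inv_pos.2 h.pos
  rw [one_div]
  exact inv_le_of_inv_le₀ h.pos (by linarith)

theorem branch_den_pos (h : Param θ m) {d : ℕ} (hd : m ≤ d) {t : ℝ} (ht : 0 ≤ t) :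
    0 < d * θ + t := by
  have := h.one_le_mul hd
  linarith

theorem branch_lt (h : Param θ m) {d : ℕ} (hd : m ≤ d) {t : ℝ} (ht : 0 < t) :
    1 / (d * θ + t) < θ := by
  have h1 := h.inv_le_mul hd
  have h2 : 0 < θ⁻¹ := inv_pos.2 h.pos
  rw [one_div]
  exact inv_lt_of_inv_lt₀ h.pos (by linarith)

end Param

variable {θ : ℝ} {m : ℕ}

theorem gaussMap_eq_fract (hθ : θ ≠ 0) (x : ℝ) :
    gaussMap θ x = θ * Int.fract (1 / (θ * x)) := by
  unfold gaussMap Int.fract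
  split_ifs with hx
  · simp [hx]
  · field_simp

theorem gaussMap_nonneg (h : Param θ m) (x : ℝ) : 0 ≤ gaussMap θ x := by
  rw [gaussMap_eq_fract h.pos.ne']
  exact mul_nonneg h.pos.le (Int.fract_nonneg _)

theorem gaussMap_lt (h : Param θ m) (x : ℝ) : gaussMap θ x < θ := by
  rw [gaussMap_eq_fract h.pos.ne']
  exact mul_lt_of_lt_one_right h.pos (Int.fract_lt_one _)

theorem measurable_gaussMap (h : Param θ m) : Measurable (gaussMap θ) := by
  have : gaussMap θ = fun x => θ * Int.fract (1 / (θ * x)) :=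
    funext fun x => gaussMap_eq_fract h.pos.ne' x
  rw [this]
  exact (measurable_fract.comp (by fun_prop)).const_mul θ

/-- The points of `[0, θ]` with an infinite expansion. -/
def Good (θ x : ℝ) : Prop := x ∈ Set.Icc 0 θ ∧ HasInfiniteExpansion θ x

theorem Good.pos {x : ℝ} (hx : Good θ x) : 0 < x :=
  lt_of_le_of_ne hx.1.1 (by simpa using (hx.2 0).symm)

theorem Good.gaussMap (h : Param θ m) {x : ℝ} (hx : Good θ x) : Good θ (gaussMap θ x) :=
  ⟨⟨gaussMap_nonneg h x, (gaussMap_lt h x).le⟩, fun n => by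
    have := hx.2 (n + 1)
    rwa [Function.iterate_succ_apply] at this⟩

theorem Good.iterate (h : Param θ m) {x : ℝ} (hx : Good θ x) (n : ℕ) :
    Good θ ((ThetaExpansion.gaussMap θ)^[n] x) := by
  induction n with
  | zero => simpa using hx
  | succ n ih => rw [Function.iterate_succ_apply']; exact ih.gaussMap h

/-- The digits, indexed from zero. -/
noncomputable def digits (θ x : ℝ) (n : ℕ) : ℕ := digit θ x (n + 1)

theorem digits_eq (x : ℝ) (n : ℕ) :
    digits θ x n = ⌊1 / (θ * (gaussMap θ)^[n] x)⌋₊ := by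
  simp [digits, digit]

theorem digits_succ (x : ℝ) (n : ℕ) :
    digits θ x (n + 1) = digits θ (gaussMap θ x) n := by
  simp [digits_eq]

theorem digits_iterate (x : ℝ) (n : ℕ) :
    digits θ x n = digits θ ((gaussMap θ)^[n] x) 0 := by
  simp [digits_eq]

theorem le_digits_zero (h : Param θ m) {x : ℝ} (hx0 : 0 < x) (hx : x ≤ θ) :
    m ≤ digits θ x 0 := by
  rw [digits_eq]
  apply Nat.le_floor
  have := h.pos
  rw [Function.iterate_zero, id, le_div_iff₀ (by positivity), ← h.mul_sq]
  have : θ * x ≤ θ ^ 2 := by nlinarith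
  gcongr

theorem Good.le_digits (h : Param θ m) {x : ℝ} (hx : Good θ x) (n : ℕ) : m ≤ digits θ x n := by
  rw [digits_iterate]
  exact le_digits_zero h (hx.iterate h n).pos (hx.iterate h n).1.2

theorem one_div_eq (h : Param θ m) {x : ℝ} (hx : 0 < x) :
    1 / x = digits θ x 0 * θ + gaussMap θ x := by
  have := h.pos
  rw [gaussMap_eq_fract h.pos.ne', digits_eq, Function.iterate_zero, id, Int.fract,
    natCast_floor_eq_intCast_floor (by positivity)]
  field_simp
  ring

theorem Good.one_div_iterate (h : Param θ m) {x : ℝ} (hx : Good θ x) (n : ℕ) :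
    1 / (ThetaExpansion.gaussMap θ)^[n] x
      = digits θ x n * θ + (ThetaExpansion.gaussMap θ)^[n + 1] x := by
  rw [one_div_eq h (hx.iterate h n).pos, digits_iterate x n, Function.iterate_succ_apply']

theorem gaussMap_branch (h : Param θ m) {d : ℕ} (hd : m ≤ d) {t : ℝ} (ht0 : 0 ≤ t)
    (ht : t < θ) : gaussMap θ (1 / (d * θ + t)) = t ∧ digits θ (1 / (d * θ + t)) 0 = d := by
  have hpos := h.branch_den_pos hd ht0
  have hθ := h.pos
  have h1 : 1 / (θ * (1 / (d * θ + t))) = t / θ + d := by field_simp; ring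
  have h2 : t / θ < 1 := (div_lt_one hθ).2 ht
  have h3 : 0 ≤ t / θ := by positivity
  constructor
  · rw [gaussMap_eq_fract hθ.ne', h1, Int.fract_add_natCast, Int.fract_eq_self.2 ⟨h3, h2⟩]
    field_simp
  · rw [digits_eq, Function.iterate_zero, id, h1, Nat.floor_add_natCast h3,
      Nat.floor_eq_zero.2 h2, zero_add]

/-- Finite truncations of the continued fraction with digits `d`. -/
noncomputable def trunc (θ : ℝ) : (ℕ → ℕ) → ℕ → ℝ
  | _, 0 => 0
  | d, n + 1 => 1 / (d 0 * θ + trunc θ (fun k => d (k + 1)) n)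

theorem trunc_mem (h : Param θ m) (n : ℕ) :
    ∀ d : ℕ → ℕ, (∀ k, m ≤ d k) → 0 ≤ trunc θ d n ∧ trunc θ d n ≤ θ := by
  induction n with
  | zero => intro d _; simp [trunc, h.pos.le]
  | succ n ih =>
    intro d hd
    have h1 := ih (fun k => d (k + 1)) fun k => hd _
    exact ⟨(one_div_pos.2 (h.branch_den_pos (hd 0) h1.1)).le, h.branch_le (hd 0) h1.1⟩

theorem branch_sub_le (h : Param θ m) {d : ℕ} (hd : m ≤ d) {s t : ℝ} (hs : 0 ≤ s) (ht : 0 ≤ t) :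
    |1 / (d * θ + s) - 1 / (d * θ + t)| ≤ θ ^ 2 * |s - t| := by
  have h1 := h.branch_den_pos hd hs
  have h2 := h.branch_den_pos hd ht
  have h3 : 1 / (d * θ + s) - 1 / (d * θ + t)
      = (1 / (d * θ + s)) * (1 / (d * θ + t)) * (t - s) := by field_simp; ring
  rw [h3, abs_mul, abs_sub_comm t s, abs_of_pos (by positivity), sq]
  have := h.pos
  gcongr
  · exact h.branch_le hd hs
  · exact h.branch_le hd ht

theorem dist_trunc_le (h : Param θ m) (n : ℕ) :
    ∀ d : ℕ → ℕ, (∀ k, m ≤ d k) → dist (trunc θ d n) (trunc θ d (n + 1)) ≤ θ * (θ ^ 2) ^ n := by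
  induction n with
  | zero =>
    intro d hd
    have := trunc_mem h 1 d hd
    rw [Real.dist_eq, show trunc θ d 0 = 0 from rfl, zero_sub, abs_neg, abs_of_nonneg this.1]
    simpa using this.2
  | succ n ih =>
    intro d hd
    have hd' : ∀ k, m ≤ d (k + 1) := fun k => hd _
    have h1 := trunc_mem h n _ hd'
    have h2 := trunc_mem h (n + 1) _ hd'
    have h3 := ih _ hd'
    rw [Real.dist_eq] at h3
    rw [Real.dist_eq, trunc, trunc]
    refine (branch_sub_le h (hd 0) h1.1 h2.1).trans ?_
    calc _ ≤ θ ^ 2 * (θ * (θ ^ 2) ^ n) := by gcongr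
      _ = _ := by ring

/-- The infinite continued fraction with digits `d`. -/
noncomputable def value (θ : ℝ) (d : ℕ → ℕ) : ℝ := limUnder atTop (trunc θ d)

theorem tendsto_trunc (h : Param θ m) {d : ℕ → ℕ} (hd : ∀ k, m ≤ d k) :
    Tendsto (trunc θ d) atTop (𝓝 (value θ d)) := by
  have : θ ^ 2 < 1 := by nlinarith [h.pos, h.lt_one]
  exact (cauchySeq_of_le_geometric _ _ this fun n => dist_trunc_le h n d hd).tendsto_limUnder

theorem value_nonneg (h : Param θ m) {d : ℕ → ℕ} (hd : ∀ k, m ≤ d k) : 0 ≤ value θ d :=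
  ge_of_tendsto' (tendsto_trunc h hd) fun n => (trunc_mem h n d hd).1

theorem value_eq (h : Param θ m) {d : ℕ → ℕ} (hd : ∀ k, m ≤ d k) :
    value θ d = 1 / (d 0 * θ + value θ (fun k => d (k + 1))) := by
  have hd' : ∀ k, m ≤ d (k + 1) := fun k => hd _
  have h1 := (tendsto_trunc h hd).comp (tendsto_add_atTop_nat 1)
  have h2 := h.branch_den_pos (hd 0) (value_nonneg h hd')
  exact tendsto_nhds_unique h1
    (tendsto_const_nhds.div ((tendsto_trunc h hd').const_add ((d 0 : ℝ) * θ)) h2.ne')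

theorem value_pos (h : Param θ m) {d : ℕ → ℕ} (hd : ∀ k, m ≤ d k) : 0 < value θ d := by
  rw [value_eq h hd]
  exact one_div_pos.2 (h.branch_den_pos (hd 0) (value_nonneg h fun k => hd _))

theorem value_lt (h : Param θ m) {d : ℕ → ℕ} (hd : ∀ k, m ≤ d k) : value θ d < θ := by
  rw [value_eq h hd]
  exact h.branch_lt (hd 0) (value_pos h fun k => hd _)

theorem gaussMap_value (h : Param θ m) {d : ℕ → ℕ} (hd : ∀ k, m ≤ d k) :
    gaussMap θ (value θ d) = value θ (fun k => d (k + 1)) ∧ digits θ (value θ d) 0 = d 0 := by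
  rw [value_eq h hd]
  exact gaussMap_branch h (hd 0) (value_nonneg h fun k => hd _) (value_lt h fun k => hd _)

theorem iterate_value (h : Param θ m) {d : ℕ → ℕ} (hd : ∀ k, m ≤ d k) (n : ℕ) :
    (gaussMap θ)^[n] (value θ d) = value θ (fun k => d (k + n)) := by
  induction n with
  | zero => simp
  | succ n ih =>
    rw [Function.iterate_succ_apply', ih, (gaussMap_value h fun k => hd _).1]
    simp only [add_assoc, add_comm 1 n]

theorem good_value (h : Param θ m) {d : ℕ → ℕ} (hd : ∀ k, m ≤ d k) : Good θ (value θ d) :=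
  ⟨⟨(value_pos h hd).le, (value_lt h hd).le⟩, fun n => by
    rw [iterate_value h hd]
    exact (value_pos h fun k => hd _).ne'⟩

theorem digits_value (h : Param θ m) {d : ℕ → ℕ} (hd : ∀ k, m ≤ d k) :
    digits θ (value θ d) = d := by
  funext n
  rw [digits_iterate, iterate_value h hd, (gaussMap_value h fun k => hd _).2, zero_add]

/-- The denominator cocycle: `denom θ d n t` is `q_n + q_{n-1} t` for the continuants of `d`. -/
noncomputable def denom (θ : ℝ) (d : ℕ → ℕ) : ℕ → ℝ → ℝ
  | 0, _ => 1
  | n + 1, t => (d n * θ + t) * denom θ d n (1 / (d n * θ + t))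

theorem denom_affine (h : Param θ m) {d : ℕ → ℕ} (hd : ∀ k, m ≤ d k) (n : ℕ) :
    ∃ A B : ℝ, 0 ≤ B ∧ B ≤ A ∧ ∀ t, 0 ≤ t → denom θ d n t = A + B * t := by
  induction n with
  | zero => exact ⟨1, 0, le_rfl, zero_le_one, fun t _ => by simp [denom]⟩
  | succ n ih =>
    obtain ⟨A, B, hB, hBA, hAB⟩ := ih
    have h1 := h.one_le_mul (hd n)
    refine ⟨A * (d n * θ) + B, A, hB.trans hBA, by nlinarith, fun t ht => ?_⟩
    have h2 := h.branch_den_pos (hd n) ht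
    rw [denom, hAB _ (by positivity)]
    field_simp
    ring

theorem inv_pow_le_denom (h : Param θ m) {d : ℕ → ℕ} (hd : ∀ k, m ≤ d k) (n : ℕ) {t : ℝ}
    (ht : 0 ≤ t) : θ⁻¹ ^ n ≤ denom θ d n t := by
  induction n generalizing t with
  | zero => simp [denom]
  | succ n ih =>
    have h1 := h.branch_den_pos (hd n) ht
    have h2 := ih (one_div_pos.2 h1).le
    have h3 := h.inv_le_mul (hd n)
    have h4 := inv_pos.2 h.pos
    rw [denom, pow_succ, mul_comm]
    gcongr
    linarith

theorem denom_pos (h : Param θ m) {d : ℕ → ℕ} (hd : ∀ k, m ≤ d k) (n : ℕ) {t : ℝ}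
    (ht : 0 ≤ t) : 0 < denom θ d n t :=
  (pow_pos (inv_pos.2 h.pos) n).trans_le (inv_pow_le_denom h hd n ht)

theorem denom_le_two_mul (h : Param θ m) {d : ℕ → ℕ} (hd : ∀ k, m ≤ d k) (n : ℕ) {s t : ℝ}
    (hs : 0 ≤ s) (ht0 : 0 ≤ t) (ht : t ≤ θ) : denom θ d n t ≤ 2 * denom θ d n s := by
  obtain ⟨A, B, hB, hBA, hAB⟩ := denom_affine h hd n
  rw [hAB _ hs, hAB _ ht0]
  have := h.lt_one
  nlinarith [mul_nonneg hB hs]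

theorem abs_sub_mul_denom (h : Param θ m) {x y : ℝ} (hx : Good θ x) (hy : Good θ y) (n : ℕ)
    (hxy : ∀ k < n, digits θ x k = digits θ y k) :
    |x - y| * denom θ (digits θ x) n ((gaussMap θ)^[n] x)
        * denom θ (digits θ x) n ((gaussMap θ)^[n] y)
      = |(gaussMap θ)^[n] x - (gaussMap θ)^[n] y| := by
  induction n with
  | zero => simp [denom]
  | succ n ih =>
    have h1 := hx.one_div_iterate h n
    have h2 := hy.one_div_iterate h n
    rw [← hxy n n.lt_succ_self] at h2
    have hx0 := (hx.iterate h n).pos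
    have hy0 := (hy.iterate h n).pos
    rw [denom, denom, ← h1, ← h2, one_div_one_div, one_div_one_div]
    have h3 : (gaussMap θ)^[n + 1] x - (gaussMap θ)^[n + 1] y
        = ((gaussMap θ)^[n] y - (gaussMap θ)^[n] x)
          * (1 / (gaussMap θ)^[n] x * (1 / (gaussMap θ)^[n] y)) := by
      have : (gaussMap θ)^[n + 1] x - (gaussMap θ)^[n + 1] y
        = 1 / (gaussMap θ)^[n] x - 1 / (gaussMap θ)^[n] y := by rw [h1, h2]; ring
      rw [this]; field_simp
    rw [h3, abs_mul, abs_sub_comm ((gaussMap θ)^[n] y), ← ih fun k hk => hxy k (hk.trans n.lt_succ_self),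
      abs_of_pos (show 0 < 1 / (gaussMap θ)^[n] x * (1 / (gaussMap θ)^[n] y) by positivity)]
    ring

theorem abs_sub_le_pow (h : Param θ m) {x y : ℝ} (hx : Good θ x) (hy : Good θ y) (n : ℕ)
    (hxy : ∀ k < n, digits θ x k = digits θ y k) : |x - y| ≤ (θ ^ 2) ^ n := by
  have h0 := abs_sub_mul_denom h hx hy n hxy
  have hx' := hx.iterate h n
  have hy' := hy.iterate h n
  have h1 : |(gaussMap θ)^[n] x - (gaussMap θ)^[n] y| ≤ 1 := by
    rw [abs_le]
    constructor <;> linarith [hx'.1.1, hx'.1.2, hy'.1.1, hy'.1.2, h.lt_one]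
  have h2 := inv_pow_le_denom h (hx.le_digits h) n hx'.1.1
  have h3 := inv_pow_le_denom h (hx.le_digits h) n hy'.1.1
  have hθ := h.pos
  have h4 : |x - y| * (θ⁻¹ ^ n * θ⁻¹ ^ n) ≤ 1 := by
    refine le_trans ?_ (h0.trans_le h1)
    rw [mul_assoc]
    have h5 : 0 < θ⁻¹ ^ n := pow_pos (inv_pos.2 hθ) n
    exact mul_le_mul_of_nonneg_left (mul_le_mul h2 h3 h5.le (h5.le.trans h2)) (abs_nonneg _)
  calc |x - y| = |x - y| * (θ⁻¹ ^ n * θ⁻¹ ^ n) * (θ ^ 2) ^ n := by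
        rw [inv_pow]; field_simp; ring
    _ ≤ 1 * (θ ^ 2) ^ n := by gcongr
    _ = _ := one_mul _

theorem Good.ext (h : Param θ m) {x y : ℝ} (hx : Good θ x) (hy : Good θ y)
    (hxy : digits θ x = digits θ y) : x = y := by
  have h1 : Tendsto (fun n : ℕ => (θ ^ 2) ^ n) atTop (𝓝 0) :=
    tendsto_pow_atTop_nhds_zero_of_lt_one (sq_nonneg θ) (by nlinarith [h.pos, h.lt_one])
  have h2 : |x - y| ≤ 0 :=
    ge_of_tendsto' h1 fun n => abs_sub_le_pow h hx hy n fun k _ => congrFun hxy k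
  exact sub_eq_zero.1 (abs_nonpos_iff.1 h2)

theorem value_digits (h : Param θ m) {x : ℝ} (hx : Good θ x) : value θ (digits θ x) = x :=
  (good_value h (hx.le_digits h)).ext h hx (digits_value h (hx.le_digits h))

end ThetaExpansion

namespace ThetaExpansion

open Filter Topology MeasureTheory Set

variable {θ : ℝ} {m : ℕ}

/-- The density of the invariant measure, up to normalisation. -/
noncomputable def density (θ t : ℝ) : ENNReal := ENNReal.ofReal (1 / (1 + θ * t))

theorem preimage_gaussMap_subset (h : Param θ m) (B : Set ℝ) :
    gaussMap θ ⁻¹' B ∩ Icc 0 θ ⊆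
      {0} ∪ ⋃ i : ℕ, (fun t : ℝ => 1 / (((m + i : ℕ) : ℝ) * θ + t)) '' (B ∩ Icc 0 θ) := by
  rintro x ⟨hxB, hx0, hxθ⟩
  rcases hx0.eq_or_lt with rfl | hx0
  · exact Or.inl rfl
  · refine Or.inr (mem_iUnion.2 ⟨digits θ x 0 - m, gaussMap θ x, ⟨hxB, gaussMap_nonneg h x,
      (gaussMap_lt h x).le⟩, ?_⟩)
    simp only
    rw [Nat.add_sub_cancel' (le_digits_zero h hx0 hxθ), ← one_div_eq h hx0, one_div_one_div]

theorem lintegral_branch_image (h : Param θ m) {d : ℕ} (hd : m ≤ d) {B : Set ℝ}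
    (hB : MeasurableSet B) (hB0 : B ⊆ Icc 0 θ) :
    ∫⁻ x in (fun t : ℝ => 1 / ((d : ℝ) * θ + t)) '' B, density θ x
      = ∫⁻ t in B, ENNReal.ofReal (θ⁻¹ * (1 / (d * θ + t) - 1 / ((d + 1 : ℕ) * θ + t))) := by
  have hden : ∀ t ∈ B, 0 < (d : ℝ) * θ + t := fun t ht => h.branch_den_pos hd (hB0 ht).1
  rw [lintegral_image_eq_lintegral_abs_deriv_mul hB
    (f' := fun t => -1 / ((d : ℝ) * θ + t) ^ 2)]
  · refine setLIntegral_congr_fun hB fun t ht => ?_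
    have h1 := hden t ht
    have h2 := h.pos
    have h3 : (0 : ℝ) < (d + 1 : ℕ) * θ + t := by push_cast; nlinarith
    simp only [density]
    rw [← ENNReal.ofReal_mul (abs_nonneg _)]
    congr 1
    rw [abs_div, abs_neg, abs_one, abs_of_pos (by positivity)]
    have h4 : 0 < (d : ℝ) * θ + t + θ := by linarith
    have h5 : ((d + 1 : ℕ) : ℝ) * θ + t = d * θ + t + θ := by push_cast; ring
    rw [h5]
    generalize (d : ℝ) * θ + t = u at *
    have h6 : 1 + θ * (1 / u) ≠ 0 := by positivity
    have : 1 + θ * (1 / u) = (u + θ) / u := by field_simp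
    rw [this]
    field_simp
    ring
  · intro t ht
    have := ((hasDerivAt_id t).const_add ((d : ℝ) * θ)).fun_inv (hden t ht).ne'
    simpa [one_div] using this.hasDerivWithinAt
  · intro s hs t ht hst
    have := inv_injective (by simpa [one_div] using hst : ((d : ℝ) * θ + s)⁻¹ = (d * θ + t)⁻¹)
    linarith

theorem tsum_branch_le (h : Param θ m) {t : ℝ} (ht : 0 ≤ t) :
    ∑' i : ℕ, ENNReal.ofReal
      (θ⁻¹ * (1 / ((m + i : ℕ) * θ + t) - 1 / ((m + i + 1 : ℕ) * θ + t))) ≤ density θ t := by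
  have hpos : ∀ i : ℕ, 0 < ((m + i : ℕ) : ℝ) * θ + t := fun i =>
    h.branch_den_pos (Nat.le_add_right m i) ht
  have hθ := h.pos
  refine ENNReal.tsum_le_of_sum_range_le fun n => ?_
  rw [← ENNReal.ofReal_sum_of_nonneg]
  · refine ENNReal.ofReal_le_ofReal ?_
    have h0 := Finset.sum_range_sub' (fun i : ℕ => 1 / (((m + i : ℕ) : ℝ) * θ + t)) n
    simp only [← add_assoc] at h0
    rw [← Finset.mul_sum, h0]
    have h1 := one_div_pos.2 (hpos n)
    have h2 : 1 / (1 + θ * t) = θ⁻¹ * (1 / (((m + 0 : ℕ) : ℝ) * θ + t)) := by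
      have h3 := h.inv_eq
      rw [add_zero, h3]
      field_simp
    rw [h2]
    gcongr
    linarith
  · intro i _
    refine mul_nonneg (inv_pos.2 hθ).le (sub_nonneg.2 ?_)
    refine one_div_le_one_div_of_le (hpos i) ?_
    push_cast
    nlinarith

/-- The measure with density `1 / (1 + θ t)` on `[0, θ]` is subinvariant. -/
theorem lintegral_preimage_gaussMap_le (h : Param θ m) {B : Set ℝ} (hB : MeasurableSet B) :
    ∫⁻ x in gaussMap θ ⁻¹' B ∩ Icc 0 θ, density θ x ≤ ∫⁻ x in B ∩ Icc 0 θ, density θ x := by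
  have hB' : MeasurableSet (B ∩ Icc 0 θ) := hB.inter measurableSet_Icc
  refine (lintegral_mono_set (preimage_gaussMap_subset h B)).trans ?_
  refine (lintegral_union_le _ _ _).trans ?_
  rw [show ∫⁻ x in {(0 : ℝ)}, density θ x = 0 from
    setLIntegral_measure_zero _ _ (by simp), zero_add]
  refine (lintegral_iUnion_le _ _).trans ?_
  simp_rw [fun i : ℕ => lintegral_branch_image h (Nat.le_add_right m i) hB' inter_subset_right]
  rw [← lintegral_tsum fun i => by fun_prop]
  exact setLIntegral_mono' hB' fun t ht => tsum_branch_le h ht.2.1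

theorem lintegral_preimage_iterate_le (h : Param θ m) (n : ℕ) {B : Set ℝ}
    (hB : MeasurableSet B) :
    ∫⁻ x in (gaussMap θ)^[n] ⁻¹' B ∩ Icc 0 θ, density θ x
      ≤ ∫⁻ x in B ∩ Icc 0 θ, density θ x := by
  induction n generalizing B with
  | zero => simp
  | succ n ih =>
    rw [Function.iterate_succ', preimage_comp]
    exact (ih (measurable_gaussMap h hB)).trans (lintegral_preimage_gaussMap_le h hB)

theorem lintegral_density_Icc_le (h : Param θ m) {s : ℝ} :
    ∫⁻ x in Icc 0 s ∩ Icc 0 θ, density θ x ≤ ENNReal.ofReal s := by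
  calc ∫⁻ x in Icc 0 s ∩ Icc 0 θ, density θ x ≤ ∫⁻ _ in Icc 0 s ∩ Icc 0 θ, 1 := by
        refine setLIntegral_mono' (measurableSet_Icc.inter measurableSet_Icc) fun t ht => ?_
        refine ENNReal.ofReal_le_one.2 ?_
        have := mul_nonneg h.pos.le ht.1.1
        rw [div_le_one (by linarith)]
        linarith
    _ ≤ volume (Icc 0 s) := by
        rw [setLIntegral_one]
        exact measure_mono inter_subset_left
    _ = _ := by simp

theorem le_lintegral_density (h : Param θ m) :
    ENNReal.ofReal (θ / 2) ≤ ∫⁻ x in Icc 0 θ, density θ x := by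
  calc ENNReal.ofReal (θ / 2) = ∫⁻ _ in Icc 0 θ, ENNReal.ofReal (1 / 2) := by
        rw [setLIntegral_const, Real.volume_Icc, ← ENNReal.ofReal_mul (by norm_num)]
        congr 1
        ring
    _ ≤ _ := by
        refine setLIntegral_mono' measurableSet_Icc fun t ht => ENNReal.ofReal_le_ofReal ?_
        have h1 := mul_nonneg h.pos.le ht.1
        have h2 : θ * t ≤ 1 := by nlinarith [ht.2, h.pos, h.lt_one, ht.1]
        exact one_div_le_one_div_of_le (by linarith) (by linarith)

/-- The points whose digits grow at most quadratically, with an explicit bound. -/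
def quadSet (θ : ℝ) (m : ℕ) : Set ℝ :=
  {x | Good θ x ∧ ∀ k, digits θ x k ≤ 4 * m * ((k + 1) * (k + 2))}

theorem mem_quadSet_of_lt (h : Param θ m) {x : ℝ} (hx : x ∈ Icc 0 θ)
    (hlt : ∀ k : ℕ, θ / 4 * (1 / (k + 1) - 1 / (k + 2)) < (gaussMap θ)^[k] x) :
    x ∈ quadSet θ m := by
  have hs : ∀ k : ℕ, θ / 4 * (1 / (k + 1) - 1 / (k + 2)) = θ / (4 * ((k + 1) * (k + 2))) := by
    intro k
    have h1 : (k : ℝ) + 1 ≠ 0 := by positivity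
    have h2 : (k : ℝ) + 2 ≠ 0 := by positivity
    field_simp
    ring
  have hθ := h.pos
  simp_rw [hs] at hlt
  have hpos : ∀ k : ℕ, 0 < (gaussMap θ)^[k] x := fun k => lt_trans (by positivity) (hlt k)
  refine ⟨⟨hx, fun k => (hpos k).ne'⟩, fun k => ?_⟩
  rw [digits_eq]
  have h2 := hpos k
  have h3 : (1 : ℝ) / (θ * (gaussMap θ)^[k] x) ≤ (4 * m * ((k + 1) * (k + 2)) : ℕ) := by
    rw [div_le_iff₀ (by positivity)]
    have h4 := (div_lt_iff₀ (by positivity)).1 (hlt k)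
    have h5 := h.mul_sq
    push_cast
    calc (1 : ℝ) = m * θ * θ := by rw [← h5]; ring
      _ ≤ m * θ * ((gaussMap θ)^[k] x * (4 * ((k + 1) * (k + 2)))) := by gcongr
      _ = _ := by ring
  exact_mod_cast (Nat.floor_le (by positivity)).trans h3

theorem tsum_bad_le (h : Param θ m) :
    ∑' k : ℕ, ENNReal.ofReal (θ / 4 * (1 / ((k : ℝ) + 1) - 1 / (k + 2)))
      ≤ ENNReal.ofReal (θ / 4) := by
  have hθ := h.pos
  refine ENNReal.tsum_le_of_sum_range_le fun n => ?_
  rw [← ENNReal.ofReal_sum_of_nonneg]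
  · refine ENNReal.ofReal_le_ofReal ?_
    have h1 := Finset.sum_range_sub' (fun i : ℕ => 1 / ((i : ℝ) + 1)) n
    have h2 : ∀ k : ℕ, (1 : ℝ) / ((k : ℝ) + 1) - 1 / (k + 2)
      = 1 / ((k : ℝ) + 1) - 1 / (((k + 1 : ℕ) : ℝ) + 1) := by
      intro k; push_cast; ring
    simp_rw [← Finset.mul_sum, h2]
    rw [h1]
    refine mul_le_of_le_one_right (by positivity) ?_
    have : 0 < 1 / ((n : ℝ) + 1) := by positivity
    simp only [Nat.cast_zero, zero_add, div_one]
    linarith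
  · intro i _
    refine mul_nonneg (by positivity) (sub_nonneg.2 ?_)
    exact one_div_le_one_div_of_le (by positivity) (by linarith)

theorem volume_quadSet_ne_zero (h : Param θ m) : volume (quadSet θ m) ≠ 0 := by
  intro h0
  set s : ℕ → ℝ := fun k => θ / 4 * (1 / ((k : ℝ) + 1) - 1 / (k + 2)) with hs
  have hcover : Icc 0 θ ⊆ quadSet θ m ∪ ⋃ k : ℕ, (gaussMap θ)^[k] ⁻¹' Icc 0 (s k) ∩ Icc 0 θ := by
    intro x hx
    by_cases hlt : ∀ k : ℕ, s k < (gaussMap θ)^[k] x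
    · exact Or.inl (mem_quadSet_of_lt h hx hlt)
    · push Not at hlt
      obtain ⟨k, hk⟩ := hlt
      refine Or.inr (mem_iUnion.2 ⟨k, ⟨?_, hk⟩, hx⟩)
      cases k with
      | zero => exact hx.1
      | succ k =>
        rw [Function.iterate_succ_apply']
        exact gaussMap_nonneg h _
  have h1 : ENNReal.ofReal (θ / 2) ≤ ENNReal.ofReal (θ / 4) := by
    calc _ ≤ ∫⁻ x in Icc 0 θ, density θ x := le_lintegral_density h
      _ ≤ _ := lintegral_mono_set hcover
      _ ≤ _ := lintegral_union_le _ _ _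
      _ = ∫⁻ x in ⋃ k : ℕ, (gaussMap θ)^[k] ⁻¹' Icc 0 (s k) ∩ Icc 0 θ, density θ x := by
          rw [setLIntegral_measure_zero _ _ h0, zero_add]
      _ ≤ _ := lintegral_iUnion_le _ _
      _ ≤ ∑' k, ENNReal.ofReal (s k) := by
          gcongr with k
          exact (lintegral_preimage_iterate_le h k measurableSet_Icc).trans
            (lintegral_density_Icc_le h)
      _ ≤ _ := tsum_bad_le h
  rw [ENNReal.ofReal_le_ofReal_iff (by linarith [h.pos])] at h1
  linarith [h.pos]

theorem one_le_dimH_quadSet (h : Param θ m) : 1 ≤ dimH (quadSet θ m) := by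
  have := le_dimH_of_hausdorffMeasure_ne_zero (s := quadSet θ m) (d := 1)
    (by rw [NNReal.coe_one, hausdorffMeasure_real]; exact volume_quadSet_ne_zero h)
  simpa using this

end ThetaExpansion

namespace ThetaExpansion

open Filter Topology Set

variable {θ : ℝ} {m : ℕ}

/-- Sequences growing slower than every exponential. -/
def SubExp (u : ℕ → ℝ) : Prop :=
  ∀ δ > 0, ∃ C, 0 < C ∧ ∀ n : ℕ, u n ≤ C * Real.exp (δ * n)

namespace SubExp

variable {u v : ℕ → ℝ}

theorem mono (hv : SubExp v) (huv : ∀ n, u n ≤ v n) : SubExp u := fun δ hδ => by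
  obtain ⟨C, hC, h⟩ := hv δ hδ
  exact ⟨C, hC, fun n => (huv n).trans (h n)⟩

theorem add (hu : SubExp u) (hv : SubExp v) : SubExp fun n => u n + v n := fun δ hδ => by
  obtain ⟨C, hC, h⟩ := hu δ hδ
  obtain ⟨D, hD, h'⟩ := hv δ hδ
  exact ⟨C + D, by positivity, fun n => by rw [add_mul]; exact add_le_add (h n) (h' n)⟩

theorem mul (hu : SubExp u) (hv : SubExp v) (hu0 : ∀ n, 0 ≤ u n) (hv0 : ∀ n, 0 ≤ v n) :
    SubExp fun n => u n * v n := fun δ hδ => by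
  obtain ⟨C, hC, h⟩ := hu (δ / 2) (by positivity)
  obtain ⟨D, hD, h'⟩ := hv (δ / 2) (by positivity)
  refine ⟨C * D, by positivity, fun n => ?_⟩
  calc u n * v n ≤ (C * Real.exp (δ / 2 * n)) * (D * Real.exp (δ / 2 * n)) :=
        mul_le_mul (h n) (h' n) (hv0 n) ((hu0 n).trans (h n))
    _ = C * D * (Real.exp (δ / 2 * n) * Real.exp (δ / 2 * n)) := by ring
    _ = _ := by rw [← Real.exp_add]; ring_nf

theorem const (c : ℝ) : SubExp fun _ => c := fun δ hδ =>
  ⟨|c| + 1, by positivity, fun n => by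
    have h1 : 1 ≤ Real.exp (δ * n) := Real.one_le_exp (by positivity)
    have h2 := le_abs_self c
    nlinarith [abs_nonneg c]⟩

theorem cast_id : SubExp fun n => n := fun δ hδ =>
  ⟨1 / δ, by positivity, fun n => by
    have := Real.add_one_le_exp (δ * n)
    rw [div_mul_eq_mul_div, one_mul, le_div_iff₀ hδ]
    linarith⟩

theorem comp_of_le (hu : SubExp u) {f : ℕ → ℕ} (hf : ∀ n, f n ≤ n + 1) :
    SubExp fun n => u (f n) := fun δ hδ => by
  obtain ⟨C, hC, h⟩ := hu δ hδ
  refine ⟨C * Real.exp δ, by positivity, fun n => (h _).trans ?_⟩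
  rw [mul_assoc, ← Real.exp_add]
  have : (f n : ℝ) ≤ n + 1 := by exact_mod_cast hf n
  gcongr
  nlinarith

end SubExp

theorem card_filter_isSquare_le (n : ℕ) :
    ((Finset.range n).filter IsSquare).card ≤ n.sqrt + 1 := by
  calc _ ≤ ((Finset.range (n.sqrt + 1)).image fun k => k * k).card := by
        refine Finset.card_le_card fun k hk => ?_
        obtain ⟨hk, r, rfl⟩ := Finset.mem_filter.1 hk
        refine Finset.mem_image.2 ⟨r, Finset.mem_range.2 (Nat.lt_succ_of_le ?_), rfl⟩
        exact Nat.le_sqrt.2 (Finset.mem_range.1 hk).le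
    _ ≤ _ := Finset.card_image_le.trans (by simp)

theorem le_two_mul_count (n : ℕ) : n ≤ 2 * Nat.count (fun k => ¬ IsSquare k) n + 3 := by
  have h1 := card_filter_isSquare_le n
  have h2 := Finset.card_filter_add_card_filter_not (s := Finset.range n) IsSquare
  rw [Nat.count_eq_card_filter_range]
  rw [Finset.card_range] at h2
  have h3 := Nat.sqrt_le n
  have h4 : 2 * n.sqrt ≤ n + 1 := by nlinarith [sq_nonneg ((n.sqrt : ℤ) - 1)]
  omega

theorem infinite_not_isSquare : (Set.ofPred fun k : ℕ => ¬ IsSquare k).Infinite := by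
  refine Set.infinite_of_forall_exists_gt fun a => ⟨(a + 1) * (a + 1) + 1, ?_, by nlinarith⟩
  rintro ⟨r, hr⟩
  have h1 : a + 1 < r := by nlinarith
  have h2 : r < a + 2 := by nlinarith
  omega

/-- Delete the entries at square positions. -/
noncomputable def deleteSquares (d : ℕ → ℕ) (k : ℕ) : ℕ :=
  d (Nat.nth (fun n => ¬ IsSquare n) k)

/-- The total weight of the entries inserted before position `n`. -/
noncomputable def insertWeight (a : ℕ → ℕ) (n : ℕ) : ℝ :=
  ∏ k ∈ Finset.range n, if IsSquare k then 2 * ((a k.sqrt : ℝ) + 1) else 1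

theorem insertWeight_pos (a : ℕ → ℕ) (n : ℕ) : 0 < insertWeight a n :=
  Finset.prod_pos fun k _ => by split_ifs <;> positivity

theorem subExp_insertWeight {a : ℕ → ℕ} (ha : SubExp fun j => a j) :
    SubExp (insertWeight a) := by
  intro δ hδ
  obtain ⟨C, hC, h⟩ := ha (δ / 2) (by positivity)
  set c : ℝ := Real.log (2 * (C + 1)) with hc
  have hc0 : 0 ≤ c := Real.log_nonneg (by linarith)
  have hexp : Real.exp c = 2 * (C + 1) := Real.exp_log (by positivity)
  refine ⟨Real.exp (c + (c + δ / 2) ^ 2 / (2 * δ)), Real.exp_pos _, fun n => ?_⟩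
  have hfac : ∀ k < n, 2 * ((a k.sqrt : ℝ) + 1) ≤ Real.exp (c + δ / 2 * n.sqrt) := by
    intro k hk
    have h1 : (k.sqrt : ℝ) ≤ n.sqrt := by exact_mod_cast Nat.sqrt_le_sqrt hk.le
    have h2 : Real.exp (δ / 2 * k.sqrt) ≤ Real.exp (δ / 2 * n.sqrt) := by gcongr
    have h3 : 1 ≤ Real.exp (δ / 2 * n.sqrt) := Real.one_le_exp (by positivity)
    rw [Real.exp_add, hexp]
    nlinarith [h k.sqrt]
  have h1 : insertWeight a n ≤ Real.exp (c + δ / 2 * n.sqrt) ^ (n.sqrt + 1) := by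
    rw [insertWeight, ← Finset.prod_filter]
    refine (Finset.prod_le_prod (fun k _ => by positivity) fun k hk => hfac k
      (Finset.mem_range.1 (Finset.mem_filter.1 hk).1)).trans ?_
    · rw [Finset.prod_const]
      exact pow_le_pow_right₀ (Real.one_le_exp (by positivity)) (card_filter_isSquare_le n)
  refine h1.trans ?_
  rw [← Real.exp_nat_mul, ← Real.exp_add]
  refine Real.exp_le_exp.2 ?_
  have h2 : (n.sqrt : ℝ) ^ 2 ≤ n := by exact_mod_cast Nat.sqrt_le' n
  have h3 : (c + δ / 2) * n.sqrt ≤ (c + δ / 2) ^ 2 / (2 * δ) + δ / 2 * (n.sqrt : ℝ) ^ 2 := by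
    have h4 : 0 ≤ ((c + δ / 2) - δ * n.sqrt) ^ 2 / (2 * δ) := by positivity
    have h5 : ((c + δ / 2) - δ * n.sqrt) ^ 2 / (2 * δ) = (c + δ / 2) ^ 2 / (2 * δ)
      + δ / 2 * (n.sqrt : ℝ) ^ 2 - (c + δ / 2) * n.sqrt := by field_simp; ring
    linarith
  push_cast
  nlinarith

theorem denom_le_insertWeight_mul (h : Param θ m) {d a : ℕ → ℕ} (hd : ∀ k, m ≤ d k)
    (hda : ∀ k, IsSquare k → d k = a k.sqrt) (n : ℕ) {t : ℝ} (ht0 : 0 ≤ t) (ht : t ≤ θ) :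
    denom θ d n t ≤ insertWeight a n
      * denom θ (deleteSquares d) (Nat.count (fun k => ¬ IsSquare k) n) t := by
  induction n generalizing t with
  | zero => simp [denom, insertWeight]
  | succ n ih =>
    have h1 := h.branch_den_pos (hd n) ht0
    have h2 := h.branch_le (hd n) ht0
    have h3 := ih (one_div_pos.2 h1).le h2
    have hW := insertWeight_pos a n
    have hd' : ∀ k, m ≤ deleteSquares d k := fun k => hd _
    rw [denom, Nat.count_succ, insertWeight, Finset.prod_range_succ, ← insertWeight]
    by_cases hn : IsSquare n
    · have h4 := denom_le_two_mul h hd' (Nat.count (fun k => ¬ IsSquare k) n) ht0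
        (one_div_pos.2 h1).le h2
      have h5 : (d n : ℝ) * θ + t ≤ a n.sqrt + 1 := by
        rw [hda n hn]
        have := h.lt_one
        have : (a n.sqrt : ℝ) * θ ≤ a n.sqrt * 1 := by gcongr
        linarith
      have h6 := denom_pos h hd' (Nat.count (fun k => ¬ IsSquare k) n) ht0
      rw [if_pos hn, if_neg (not_not.2 hn), add_zero]
      calc _ ≤ ((a n.sqrt : ℝ) + 1) * (insertWeight a n
              * (2 * denom θ (deleteSquares d) (Nat.count (fun k => ¬ IsSquare k) n) t)) := by
            refine mul_le_mul h5 (h3.trans ?_) (denom_pos h hd n (one_div_pos.2 h1).le).le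
              (by positivity)
            gcongr
        _ = _ := by ring
    · have h4 : deleteSquares d (Nat.count (fun k => ¬ IsSquare k) n) = d n := by
        rw [deleteSquares, Nat.nth_count (p := fun k => ¬ IsSquare k) hn]
      rw [if_neg hn, if_pos hn, denom, h4, mul_one]
      calc _ ≤ ((d n : ℝ) * θ + t) * _ := mul_le_mul_of_nonneg_left h3 h1.le
        _ = _ := by ring

theorem inv_digits_le (h : Param θ m) {x : ℝ} (hx : Good θ x) :
    1 / ((digits θ x 0 : ℝ) + 1) ≤ x := by
  have h1 := one_div_eq h hx.pos
  have h2 : 1 / x ≤ (digits θ x 0 : ℝ) + 1 := by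
    rw [h1]
    have := (hx.gaussMap h).1.2
    have := h.lt_one
    have : (digits θ x 0 : ℝ) * θ ≤ digits θ x 0 * 1 := by gcongr
    linarith
  have := one_div_le_one_div_of_le (one_div_pos.2 hx.pos) h2
  rwa [one_div_one_div] at this

theorem le_abs_sub_of_digits_lt (h : Param θ m) {x y : ℝ} (hx : Good θ x) (hy : Good θ y)
    (hxy : digits θ x 0 < digits θ y 0) :
    1 / (((digits θ x 0 : ℝ) + 1) * (digits θ y 0 + 1) * (digits θ y 1 + 1)) ≤ |x - y| := by
  have hx0 := hx.pos
  have hy0 := hy.pos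
  have h1 := one_div_eq h hx0
  have h2 := one_div_eq h hy0
  have h3 := inv_digits_le h hx
  have h4 := inv_digits_le h hy
  have h5 := inv_digits_le h (hy.gaussMap h)
  rw [← digits_succ] at h5
  have h6 : 1 / ((digits θ y 1 : ℝ) + 1) ≤ 1 / y - 1 / x := by
    have h7 : (digits θ x 0 : ℝ) + 1 ≤ digits θ y 0 := by exact_mod_cast hxy
    have h8 := (hx.gaussMap h).1.2
    have := h.pos
    rw [h1, h2]
    nlinarith
  have h9 : x - y = x * y * (1 / y - 1 / x) := by field_simp
  calc _ = 1 / ((digits θ x 0 : ℝ) + 1) * (1 / ((digits θ y 0 : ℝ) + 1))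
        * (1 / ((digits θ y 1 : ℝ) + 1)) := by field_simp
    _ ≤ x * y * (1 / y - 1 / x) := by gcongr
    _ ≤ _ := by rw [← h9]; exact le_abs_self _

/-- Points whose digit at position `j²` (counted from zero) is `a j`, and whose other digits grow
at most quadratically. -/
def insertSet (θ : ℝ) (m : ℕ) (a : ℕ → ℕ) : Set ℝ :=
  {x | Good θ x ∧ ∀ n, (IsSquare n → digits θ x n = a n.sqrt) ∧
    (¬ IsSquare n → digits θ x n ≤ 4 * m * ((n + 1) * (n + 2)))}

/-- The map deleting the digits at square positions. -/
noncomputable def deleteMap (θ x : ℝ) : ℝ := value θ (deleteSquares (digits θ x))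

/-- A bound for the digits of points of `insertSet` at positions `n` (if not a square), `n + 1`. -/
noncomputable def digitBound (m : ℕ) (a : ℕ → ℕ) (n : ℕ) : ℝ :=
  4 * m * ((n + 2) * (n + 3)) + a (n + 1).sqrt + 1

theorem digits_le_digitBound {a : ℕ → ℕ} {x : ℝ} (hx : x ∈ insertSet θ m a) (n : ℕ) :
    (digits θ x (n + 1) : ℝ) + 1 ≤ digitBound m a n ∧
      (¬ IsSquare n → (digits θ x n : ℝ) + 1 ≤ digitBound m a n) := by
  unfold digitBound
  constructor
  · by_cases hn : IsSquare (n + 1)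
    · rw [(hx.2 (n + 1)).1 hn]
      have : (0 : ℝ) ≤ 4 * m * ((n + 2) * (n + 3)) := by positivity
      linarith
    · have h1 : (digits θ x (n + 1) : ℝ) ≤ (4 * m * ((n + 1 + 1) * (n + 1 + 2)) : ℕ) := by
        exact_mod_cast (hx.2 (n + 1)).2 hn
      push_cast at h1
      have : (0 : ℝ) ≤ a (n + 1).sqrt := by positivity
      nlinarith
  · intro hn
    have h1 : (digits θ x n : ℝ) ≤ (4 * m * ((n + 1) * (n + 2)) : ℕ) := by
      exact_mod_cast (hx.2 n).2 hn
    push_cast at h1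
    have h2 : (0 : ℝ) ≤ a (n + 1).sqrt := by positivity
    have h3 : (4 : ℝ) * m * ((n + 1) * (n + 2)) ≤ 4 * m * ((n + 2) * (n + 3)) := by
      gcongr ?_ * ?_
      nlinarith
    linarith

theorem subExp_digitBound {a : ℕ → ℕ} (ha : SubExp fun j => a j) : SubExp (digitBound m a) := by
  have h1 : SubExp fun n : ℕ => (n : ℝ) + 2 := SubExp.cast_id.add (SubExp.const 2)
  have h2 : SubExp fun n : ℕ => (n : ℝ) + 3 := SubExp.cast_id.add (SubExp.const 3)
  have h3 := h1.mul h2 (fun n => by positivity) fun n => by positivity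
  have h4 := (SubExp.const (4 * m)).mul h3 (fun n => by positivity) fun n => by positivity
  exact (h4.add (ha.comp_of_le fun n => Nat.sqrt_le_self _)).add (SubExp.const 1)

theorem abs_deleteMap_sub_le (h : Param θ m) {a : ℕ → ℕ} {x y : ℝ} (hx : x ∈ insertSet θ m a)
    (hy : y ∈ insertSet θ m a) {n : ℕ} (hxy : ∀ k < n, digits θ x k = digits θ y k)
    (hn : digits θ x n < digits θ y n) :
    |deleteMap θ x - deleteMap θ y|
        ≤ 4 * insertWeight a n ^ 2 * digitBound m a n ^ 3 * |x - y| ∧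
      |deleteMap θ x - deleteMap θ y| ≤ (θ ^ 2) ^ Nat.count (fun k => ¬ IsSquare k) n := by
  have hnsq : ¬ IsSquare n := fun hs => by
    rw [(hx.2 n).1 hs, (hy.2 n).1 hs] at hn
    exact lt_irrefl _ hn
  set n' := Nat.count (fun k => ¬ IsSquare k) n with hn'
  have hdx : ∀ k, m ≤ deleteSquares (digits θ x) k := fun k => hx.1.le_digits h _
  have hdy : ∀ k, m ≤ deleteSquares (digits θ y) k := fun k => hy.1.le_digits h _
  have hgx : Good θ (deleteMap θ x) := good_value h hdx
  have hgy : Good θ (deleteMap θ y) := good_value h hdy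
  have hdgx : digits θ (deleteMap θ x) = deleteSquares (digits θ x) := digits_value h hdx
  have hdgy : digits θ (deleteMap θ y) = deleteSquares (digits θ y) := digits_value h hdy
  have hagree : ∀ k < n', digits θ (deleteMap θ x) k = digits θ (deleteMap θ y) k := by
    intro k hk
    rw [hdgx, hdgy]
    exact hxy _ (Nat.nth_lt_of_lt_count hk)
  refine ⟨?_, abs_sub_le_pow h hgx hgy n' hagree⟩
  have e1 := abs_sub_mul_denom h hx.1 hy.1 n hxy
  have e2 := abs_sub_mul_denom h hgx hgy n' hagree
  rw [hdgx] at e2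
  have hX := hx.1.iterate h n
  have hY := hy.1.iterate h n
  have hX' := hgx.iterate h n'
  have hY' := hgy.iterate h n'
  have hW := insertWeight_pos a n
  have key : ∀ {u v : ℝ}, 0 ≤ u → u ≤ θ → 0 ≤ v → v ≤ θ → denom θ (digits θ x) n u
      ≤ 2 * insertWeight a n * denom θ (deleteSquares (digits θ x)) n' v := by
    intro u v hu0 hu hv0 hv
    refine (denom_le_insertWeight_mul h (hx.1.le_digits h) (fun k => (hx.2 k).1) n hu0 hu).trans ?_
    rw [mul_comm 2, mul_assoc]
    gcongr
    exact denom_le_two_mul h hdx n' hv0 hu0 hu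
  have k1 := key hX.1.1 hX.1.2 hX'.1.1 hX'.1.2
  have k2 := key hY.1.1 hY.1.2 hY'.1.1 hY'.1.2
  set F1 := denom θ (digits θ x) n ((gaussMap θ)^[n] x)
  set F2 := denom θ (digits θ x) n ((gaussMap θ)^[n] y)
  set G1 := denom θ (deleteSquares (digits θ x)) n' ((gaussMap θ)^[n'] (deleteMap θ x))
  set G2 := denom θ (deleteSquares (digits θ x)) n' ((gaussMap θ)^[n'] (deleteMap θ y))
  have hF2 : 0 < F2 := denom_pos h (hx.1.le_digits h) n hY.1.1
  have hG1 : 0 < G1 := denom_pos h hdx n' hX'.1.1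
  have sep := le_abs_sub_of_digits_lt h hX hY (by rwa [← digits_iterate, ← digits_iterate])
  have hsucc : digits θ ((gaussMap θ)^[n] y) 1 = digits θ y (n + 1) := by
    rw [digits_iterate y, digits_iterate _ 1, ← Function.iterate_add_apply, add_comm]
  rw [← digits_iterate, ← digits_iterate, hsucc, ← e1] at sep
  have hle1 : |deleteMap θ x - deleteMap θ y| * G1 * G2 ≤ 1 := by
    rw [e2, abs_le]
    constructor <;> linarith [hX'.1.1, hX'.1.2, hY'.1.1, hY'.1.2, h.lt_one]
  set D := digitBound m a n
  have b1 := (digits_le_digitBound hx n).2 hnsq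
  have b2 := (digits_le_digitBound hy n).2 hnsq
  have b3 := (digits_le_digitBound hy n).1
  have hD0 : 0 ≤ D := le_trans (by positivity) b1
  have hprod : ((digits θ x n : ℝ) + 1) * (digits θ y n + 1) * (digits θ y (n + 1) + 1) ≤ D ^ 3 := by
    calc _ ≤ D * D * D := by gcongr
      _ = _ := by ring
  have hD : 0 < D ^ 3 := lt_of_lt_of_le (by positivity) hprod
  have sep' : 1 / D ^ 3 ≤ |x - y| * F1 * F2 :=
    (one_div_le_one_div_of_le (by positivity) hprod).trans sep
  have sep2 : 1 ≤ D ^ 3 * (|x - y| * ((2 * insertWeight a n * G1) * (2 * insertWeight a n * G2))) := by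
    rw [div_le_iff₀' hD] at sep'
    refine sep'.trans ?_
    rw [mul_assoc |x - y|]
    gcongr
  calc |deleteMap θ x - deleteMap θ y| = |deleteMap θ x - deleteMap θ y| * 1 := (mul_one _).symm
    _ ≤ |deleteMap θ x - deleteMap θ y| * _ := mul_le_mul_of_nonneg_left sep2 (abs_nonneg _)
    _ = (4 * insertWeight a n ^ 2 * D ^ 3 * |x - y|)
        * (|deleteMap θ x - deleteMap θ y| * G1 * G2) := by ring
    _ ≤ (4 * insertWeight a n ^ 2 * D ^ 3 * |x - y|) * 1 := by gcongr
    _ = _ := mul_one _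

theorem exists_abs_deleteMap_rpow_le (h : Param θ m) {a : ℕ → ℕ} (ha : SubExp fun j => a j)
    {δ : ℝ} (hδ : 0 < δ) : ∃ C : ℝ, 0 < C ∧ ∀ x ∈ insertSet θ m a, ∀ y ∈ insertSet θ m a,
      |deleteMap θ x - deleteMap θ y| ^ (1 + δ) ≤ C * |x - y| := by
  have hθ := h.pos
  set κ : ℝ := -Real.log (θ ^ 2) with hκ
  have hθ2 : θ ^ 2 < 1 := by nlinarith [h.lt_one]
  have hκ0 : 0 < κ := neg_pos.2 (Real.log_neg (by positivity) hθ2)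
  have hW := subExp_insertWeight ha
  have hD := subExp_digitBound (m := m) ha
  have hW0 : ∀ n, 0 ≤ insertWeight a n := fun n => (insertWeight_pos a n).le
  have hD0 : ∀ n, 0 ≤ digitBound m a n := fun n => by unfold digitBound; positivity
  have hW2 := hW.mul hW hW0 hW0
  have hD2 := hD.mul hD hD0 hD0
  have hD3 := hD2.mul hD (fun n => mul_nonneg (hD0 n) (hD0 n)) hD0
  have hU := ((SubExp.const 4).mul hW2 (fun _ => by norm_num) fun n => mul_nonneg (hW0 n) (hW0 n)).mul
    hD3 (fun n => mul_nonneg (by norm_num) (mul_nonneg (hW0 n) (hW0 n)))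
    (fun n => mul_nonneg (mul_nonneg (hD0 n) (hD0 n)) (hD0 n))
  obtain ⟨C, hC, hCU⟩ := hU (κ * δ / 2) (by positivity)
  refine ⟨C * Real.exp (3 * κ * δ / 2), by positivity, ?_⟩
  have main : ∀ x ∈ insertSet θ m a, ∀ y ∈ insertSet θ m a, ∀ n,
      (∀ k < n, digits θ x k = digits θ y k) → digits θ x n < digits θ y n →
      |deleteMap θ x - deleteMap θ y| ^ (1 + δ) ≤ C * Real.exp (3 * κ * δ / 2) * |x - y| := by
    intro x hx y hy n hxy hn
    obtain ⟨h1, h2⟩ := abs_deleteMap_sub_le h hx hy hxy hn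
    set n' := Nat.count (fun k => ¬ IsSquare k) n
    have h3 : |deleteMap θ x - deleteMap θ y| ^ δ ≤ Real.exp (-(κ * δ * n')) := by
      calc _ ≤ ((θ ^ 2) ^ n') ^ δ := Real.rpow_le_rpow (abs_nonneg _) h2 hδ.le
        _ = Real.exp (-(κ * δ * n')) := by
          rw [← Real.rpow_natCast (θ ^ 2), ← Real.rpow_mul (by positivity),
            Real.rpow_def_of_pos (by positivity), hκ]
          ring_nf
    have h4 : (n : ℝ) ≤ 2 * n' + 3 := by exact_mod_cast le_two_mul_count n
    have h5 : 4 * insertWeight a n ^ 2 * digitBound m a n ^ 3 ≤ C * Real.exp (κ * δ / 2 * n) := by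
      refine le_trans (le_of_eq ?_) (hCU n)
      ring
    rw [Real.rpow_add_of_nonneg (abs_nonneg _) zero_le_one hδ.le, Real.rpow_one]
    calc _ ≤ (C * Real.exp (κ * δ / 2 * n) * |x - y|) * Real.exp (-(κ * δ * n')) := by
          refine mul_le_mul (h1.trans ?_) h3 (by positivity) (by positivity)
          gcongr
      _ = C * (Real.exp (κ * δ / 2 * n) * Real.exp (-(κ * δ * n'))) * |x - y| := by ring
      _ ≤ _ := by
          rw [← Real.exp_add]
          gcongr
          nlinarith [mul_pos hκ0 hδ]
  intro x hx y hy
  by_cases hxy : digits θ x = digits θ y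
  · rw [hx.1.ext h hy.1 hxy, sub_self, abs_zero, sub_self, abs_zero, Real.zero_rpow (by positivity),
      mul_zero]
  · have hex : ∃ n, digits θ x n ≠ digits θ y n := Function.ne_iff.1 hxy
    classical
    have hmin : ∀ k < Nat.find hex, digits θ x k = digits θ y k := fun k hk =>
      not_not.1 (Nat.find_min hex hk)
    rcases lt_or_gt_of_ne (Nat.find_spec hex) with hlt | hlt
    · exact main x hx y hy _ hmin hlt
    · rw [abs_sub_comm, abs_sub_comm x]
      exact main y hy x hx _ (fun k hk => (hmin k hk).symm) hlt

theorem holderOnWith_deleteMap (h : Param θ m) {a : ℕ → ℕ} (ha : SubExp fun j => a j)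
    {r : NNReal} (hr0 : 0 < r) (hr : r < 1) :
    ∃ C, HolderOnWith C r (deleteMap θ) (insertSet θ m a) := by
  have hr0' : (0 : ℝ) < r := hr0
  have hr' : (r : ℝ) < 1 := hr
  have hδ : 0 < (r : ℝ)⁻¹ - 1 := sub_pos.2 ((one_lt_inv₀ hr0').2 hr')
  obtain ⟨C, hC, hCxy⟩ := exists_abs_deleteMap_rpow_le h ha hδ
  refine ⟨(C ^ (r : ℝ)).toNNReal, fun x hx y hy => ?_⟩
  have h1 := Real.rpow_le_rpow (by positivity) (hCxy x hx y hy) hr0'.le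
  rw [add_sub_cancel, ← Real.rpow_mul (abs_nonneg _), inv_mul_cancel₀ hr0'.ne', Real.rpow_one,
    Real.mul_rpow hC.le (abs_nonneg _)] at h1
  rw [edist_dist, edist_dist, Real.dist_eq, Real.dist_eq,
    ENNReal.ofReal_rpow_of_nonneg (abs_nonneg _) hr0'.le, ← ENNReal.ofReal,
    ← ENNReal.ofReal_mul (by positivity)]
  exact ENNReal.ofReal_le_ofReal h1

theorem quadSet_subset_image (h : Param θ m) {a : ℕ → ℕ} (ha : ∀ j, m ≤ a j) :
    quadSet θ m ⊆ deleteMap θ '' insertSet θ m a := by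
  rintro x ⟨hx, hxq⟩
  set d : ℕ → ℕ := fun n => if IsSquare n then a n.sqrt else
    digits θ x (Nat.count (fun k => ¬ IsSquare k) n) with hd
  have hdm : ∀ k, m ≤ d k := fun k => by
    simp only [hd]
    split_ifs
    · exact ha _
    · exact hx.le_digits h _
  have hdel : deleteSquares d = digits θ x := by
    funext k
    have := Nat.nth_mem_of_infinite infinite_not_isSquare k
    simp only [deleteSquares, hd]
    rw [if_neg this, Nat.count_nth_of_infinite infinite_not_isSquare]
  refine ⟨value θ d, ⟨good_value h hdm, fun n => ?_⟩, ?_⟩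
  · rw [digits_value h hdm]
    refine ⟨fun hn => if_pos hn, fun hn => ?_⟩
    simp only [hd]
    rw [if_neg hn]
    refine (hxq _).trans ?_
    have : Nat.count (fun k => ¬ IsSquare k) n ≤ n := Nat.count_le _
    gcongr
  · rw [deleteMap, digits_value h hdm, hdel, value_digits h hx]

theorem one_le_dimH_insertSet (h : Param θ m) {a : ℕ → ℕ} (ha : ∀ j, m ≤ a j)
    (ha' : SubExp fun j => a j) : 1 ≤ dimH (insertSet θ m a) := by
  refine ENNReal.le_of_forall_nnreal_lt fun r hr => ?_
  rcases eq_or_ne r 0 with rfl | hr0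
  · simp
  have hr1 : r < 1 := by exact_mod_cast hr
  obtain ⟨C, hC⟩ := holderOnWith_deleteMap h ha' (pos_iff_ne_zero.2 hr0) hr1
  have h1 := (one_le_dimH_quadSet h).trans (dimH_mono (quadSet_subset_image h ha))
  have h2 := h1.trans (hC.dimH_image_le (pos_iff_ne_zero.2 hr0))
  rwa [ENNReal.le_div_iff_mul_le (by simp [hr0]) (by simp), one_mul] at h2

end ThetaExpansion

namespace ThetaExpansion

open Filter Topology Set

/-- The normalising function `log t · log log t`. -/
noncomputable def logLogLog (t : ℝ) : ℝ := Real.log t * Real.log (Real.log t)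

theorem tendsto_natCast_sq : Tendsto (fun j : ℕ => (j : ℝ) ^ 2) atTop atTop :=
  (tendsto_pow_atTop two_ne_zero).comp tendsto_natCast_atTop_atTop

theorem tendsto_logLogLog_sq : Tendsto (fun j : ℕ => logLogLog ((j : ℝ) ^ 2)) atTop atTop :=
  (Real.tendsto_log_atTop.comp tendsto_natCast_sq).atTop_mul_atTop₀
    (Real.tendsto_log_atTop.comp (Real.tendsto_log_atTop.comp tendsto_natCast_sq))

theorem logLogLog_sq_nonneg (j : ℕ) : 0 ≤ logLogLog ((j : ℝ) ^ 2) := by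
  rcases lt_or_ge j 2 with hj | hj
  · interval_cases j <;> simp [logLogLog]
  · have h1 : (2 : ℝ) ≤ j := by exact_mod_cast hj
    have h2 : 1 ≤ Real.log ((j : ℝ) ^ 2) := by
      rw [Real.le_log_iff_exp_le (by positivity)]
      nlinarith [Real.exp_one_lt_d9]
    exact mul_nonneg (by linarith) (Real.log_nonneg h2)

theorem logLogLog_mono {s t : ℝ} (hs : Real.exp 1 ≤ s) (hst : s ≤ t) :
    logLogLog s ≤ logLogLog t := by
  have hs0 : 0 < s := (Real.exp_pos 1).trans_le hs
  have h1 : 1 ≤ Real.log s := (Real.le_log_iff_exp_le hs0).2 hs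
  have h2 : Real.log s ≤ Real.log t := Real.log_le_log hs0 hst
  have h3 : Real.log (Real.log s) ≤ Real.log (Real.log t) :=
    Real.log_le_log (by linarith) h2
  exact mul_le_mul h2 h3 (Real.log_nonneg h1) (by linarith)

theorem eventually_logLogLog_succ_le : ∀ᶠ j : ℕ in atTop,
    logLogLog (((j : ℝ) + 1) ^ 2) ≤ (1 + 1 / (j : ℝ)) ^ 2 * logLogLog ((j : ℝ) ^ 2) := by
  have h1 := (Real.tendsto_log_atTop.comp (Real.tendsto_log_atTop.comp
    tendsto_natCast_sq)).eventually_ge_atTop 1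
  have h2 := (Real.tendsto_log_atTop.comp tendsto_natCast_sq).eventually_ge_atTop 2
  filter_upwards [h1, h2, eventually_ge_atTop 1] with j h1 h2 hj
  simp only [Function.comp_apply] at h1 h2
  have hj' : (0 : ℝ) < j := by exact_mod_cast hj
  have h3 : Real.log (1 + 1 / (j : ℝ)) ≤ 1 / j := by
    have := Real.log_le_sub_one_of_pos (show (0 : ℝ) < 1 + 1 / j by positivity)
    linarith
  have hinv : (0 : ℝ) < 1 / j := by positivity
  set u := Real.log ((j : ℝ) ^ 2) with hu
  have h4 : Real.log (((j : ℝ) + 1) ^ 2) ≤ u * (1 + 1 / j) := by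
    have : (j : ℝ) + 1 = j * (1 + 1 / j) := by field_simp
    rw [this, mul_pow, Real.log_mul (by positivity) (by positivity), ← hu, Real.log_pow]
    push_cast
    nlinarith
  have h5 : u ≤ Real.log (((j : ℝ) + 1) ^ 2) :=
    Real.log_le_log (by positivity) (by gcongr; linarith)
  have h6 : Real.log (Real.log (((j : ℝ) + 1) ^ 2)) ≤ Real.log u * (1 + 1 / j) := by
    calc _ ≤ Real.log (u * (1 + 1 / j)) := Real.log_le_log (by linarith) h4
      _ = Real.log u + Real.log (1 + 1 / j) := Real.log_mul (by linarith) (by positivity)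
      _ ≤ _ := by nlinarith
  unfold logLogLog
  rw [← hu]
  calc _ ≤ (u * (1 + 1 / j)) * (Real.log u * (1 + 1 / j)) := by
        refine mul_le_mul h4 h6 (Real.log_nonneg (by linarith)) (by positivity)
    _ = _ := by ring

/-- The relative size of the inserted digits. -/
noncomputable def relSize (α : ℝ) (j : ℕ) : ℝ :=
  α / logLogLog ((j : ℝ) ^ 2) + 1 / √((j : ℝ) + 1)

/-- The approximate sum of the inserted digits. -/
noncomputable def approxSum (α : ℝ) (j : ℕ) : ℝ :=
  Real.exp (∑ i ∈ Finset.range j, relSize α i)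

/-- The inserted digits. -/
noncomputable def insDigit (m : ℕ) (α : ℝ) (j : ℕ) : ℕ := m + ⌈relSize α j * approxSum α j⌉₊

variable {α : ℝ} {m : ℕ}

theorem inv_sqrt_le_relSize (hα : 0 ≤ α) (j : ℕ) : 1 / √((j : ℝ) + 1) ≤ relSize α j :=
  le_add_of_nonneg_left (div_nonneg hα (logLogLog_sq_nonneg j))

theorem relSize_pos (hα : 0 ≤ α) (j : ℕ) : 0 < relSize α j :=
  lt_of_lt_of_le (by positivity) (inv_sqrt_le_relSize hα j)

theorem approxSum_succ (j : ℕ) :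
    approxSum α (j + 1) = approxSum α j * Real.exp (relSize α j) := by
  rw [approxSum, Finset.sum_range_succ, Real.exp_add, approxSum]

theorem approxSum_pos (j : ℕ) : 0 < approxSum α j := Real.exp_pos _

theorem tendsto_sqrt_succ : Tendsto (fun j : ℕ => √((j : ℝ) + 1)) atTop atTop :=
  Real.tendsto_sqrt_atTop.comp (tendsto_atTop_add_const_right _ _ tendsto_natCast_atTop_atTop)

theorem tendsto_relSize : Tendsto (relSize α) atTop (𝓝 0) := by
  have h1 : Tendsto (fun j : ℕ => α / logLogLog ((j : ℝ) ^ 2)) atTop (𝓝 0) :=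
    tendsto_logLogLog_sq.const_div_atTop α
  have h2 : Tendsto (fun j : ℕ => 1 / √((j : ℝ) + 1)) atTop (𝓝 0) :=
    tendsto_sqrt_succ.const_div_atTop 1
  have h3 := h1.add h2
  rwa [add_zero] at h3

theorem tendsto_logLogLog_div_sqrt :
    Tendsto (fun j : ℕ => logLogLog ((j : ℝ) ^ 2) / √((j : ℝ) + 1)) atTop (𝓝 0) := by
  have h1 : Tendsto (fun j : ℕ => 16 * (Real.log √((j : ℝ) + 1) ^ 2 / √((j : ℝ) + 1)))
      atTop (𝓝 0) := by
    simpa using ((Real.isLittleO_pow_log_id_atTop (n := 2)).tendsto_div_nhds_zero.comp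
      tendsto_sqrt_succ).const_mul 16
  refine squeeze_zero' (Eventually.of_forall fun j =>
    div_nonneg (logLogLog_sq_nonneg j) (Real.sqrt_nonneg _)) ?_ h1
  filter_upwards [(Real.tendsto_log_atTop.comp tendsto_natCast_sq).eventually_ge_atTop 1,
    eventually_ge_atTop 1] with j h2 hj
  simp only [Function.comp_apply] at h2
  have hj' : (0 : ℝ) < j := by exact_mod_cast hj
  have h3 : Real.log ((j : ℝ) ^ 2) ≤ 4 * Real.log √((j : ℝ) + 1) := by
    rw [Real.log_sqrt (by positivity), Real.log_pow]
    have := Real.log_le_log hj' (show (j : ℝ) ≤ j + 1 by linarith)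
    push_cast
    linarith
  have h4 : Real.log (Real.log ((j : ℝ) ^ 2)) ≤ Real.log ((j : ℝ) ^ 2) :=
    (Real.log_le_sub_one_of_pos (by linarith)).trans (by linarith)
  rw [← mul_div_assoc]
  gcongr
  unfold logLogLog
  nlinarith

theorem tendsto_relSize_mul (α : ℝ) :
    Tendsto (fun j : ℕ => relSize α j * logLogLog ((j : ℝ) ^ 2)) atTop (𝓝 α) := by
  have h1 := tendsto_logLogLog_div_sqrt.const_add α
  rw [add_zero] at h1
  refine h1.congr' ?_
  filter_upwards [tendsto_logLogLog_sq.eventually_gt_atTop 0] with j hj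
  rw [relSize]
  field_simp

theorem sqrt_le_sum_relSize (hα : 0 ≤ α) (j : ℕ) :
    √(j : ℝ) ≤ ∑ i ∈ Finset.range j, relSize α i := by
  induction j with
  | zero => simp
  | succ j ih =>
    rw [Finset.sum_range_succ]
    have h1 := inv_sqrt_le_relSize hα j
    have h2 : √((j + 1 : ℕ) : ℝ) ≤ √j + 1 / √((j : ℝ) + 1) := by
      have hs : 0 < √((j : ℝ) + 1) := by positivity
      have h3 : √((j : ℝ) + 1) * √((j : ℝ) + 1) = j + 1 := Real.mul_self_sqrt (by positivity)
      have h4 : √(j : ℝ) * √j = j := Real.mul_self_sqrt (by positivity)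
      have h5 : √(j : ℝ) ≤ √((j : ℝ) + 1) := Real.sqrt_le_sqrt (by linarith)
      push_cast
      rw [← sub_le_iff_le_add', le_div_iff₀ hs]
      nlinarith [Real.sqrt_nonneg (j : ℝ)]
    linarith

theorem exp_sqrt_le_approxSum (hα : 0 ≤ α) (j : ℕ) : Real.exp √(j : ℝ) ≤ approxSum α j :=
  Real.exp_le_exp.2 (sqrt_le_sum_relSize hα j)

/-- Any fixed power is negligible against the inserted digits. -/
theorem tendsto_pow_div_relSize_mul (hα : 0 ≤ α) (p : ℕ) :
    Tendsto (fun j : ℕ => ((j : ℝ) + 1) ^ p / (relSize α j * approxSum α j)) atTop (𝓝 0) := by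
  have h1 : Tendsto (fun j : ℕ => Real.exp 1
      * (√((j : ℝ) + 1) ^ (2 * p + 1) * Real.exp (-√((j : ℝ) + 1)))) atTop (𝓝 0) := by
    simpa using ((Real.tendsto_pow_mul_exp_neg_atTop_nhds_zero (2 * p + 1)).comp
      tendsto_sqrt_succ).const_mul (Real.exp 1)
  refine squeeze_zero (fun j => div_nonneg (by positivity)
    (mul_pos (relSize_pos hα j) (approxSum_pos j)).le) (fun j => ?_) h1
  have hs : 0 < √((j : ℝ) + 1) := by positivity
  have h2 := inv_sqrt_le_relSize hα j
  have h3 := exp_sqrt_le_approxSum hα j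
  have h4 : √((j : ℝ) + 1) ≤ √j + 1 := by
    have h5 : √(j : ℝ) ^ 2 = j := Real.sq_sqrt (by positivity)
    exact Real.sqrt_le_iff.2 ⟨by positivity, by nlinarith [Real.sqrt_nonneg (j : ℝ)]⟩
  have h5 : √((j : ℝ) + 1) ^ 2 = j + 1 := Real.sq_sqrt (by positivity)
  have h6 : Real.exp (√((j : ℝ) + 1) - 1) ≤ approxSum α j :=
    (Real.exp_le_exp.2 (by linarith)).trans h3
  calc ((j : ℝ) + 1) ^ p / (relSize α j * approxSum α j)
      ≤ ((j : ℝ) + 1) ^ p / (1 / √((j : ℝ) + 1) * Real.exp (√((j : ℝ) + 1) - 1)) := by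
        exact div_le_div_of_nonneg_left (by positivity) (by positivity)
          (mul_le_mul h2 h6 (Real.exp_pos _).le (relSize_pos hα j).le)
    _ = _ := by
        rw [Real.exp_sub, Real.exp_neg, pow_succ, pow_mul, h5]
        field_simp

theorem tendsto_relSize_mul_approxSum (hα : 0 ≤ α) :
    Tendsto (fun j : ℕ => relSize α j * approxSum α j) atTop atTop := by
  have h1 := tendsto_pow_div_relSize_mul hα 0
  simp only [pow_zero] at h1
  have h2 : Tendsto (fun j : ℕ => 1 / (relSize α j * approxSum α j)) atTop (𝓝[>] 0) :=
    tendsto_nhdsWithin_iff.2 ⟨h1, Eventually.of_forall fun j =>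
      one_div_pos.2 (mul_pos (relSize_pos hα j) (approxSum_pos j))⟩
  simpa [Function.comp_def] using tendsto_inv_nhdsGT_zero.comp h2

theorem tendsto_insDigit_div (hα : 0 ≤ α) :
    Tendsto (fun j : ℕ => (insDigit m α j : ℝ) / (relSize α j * approxSum α j)) atTop (𝓝 1) := by
  have h1 := (tendsto_nat_ceil_div_atTop (R := ℝ)).comp (tendsto_relSize_mul_approxSum hα)
  have h2 : Tendsto (fun j : ℕ => (m : ℝ) / (relSize α j * approxSum α j)) atTop (𝓝 0) :=
    (tendsto_relSize_mul_approxSum hα).const_div_atTop _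
  have h3 := h2.add h1
  rw [zero_add] at h3
  refine h3.congr fun j => ?_
  rw [insDigit, Nat.cast_add, add_div, Function.comp_apply]

theorem eventually_relSize_mul_approxSum_mono (hα : 0 ≤ α) : ∀ᶠ j : ℕ in atTop,
    relSize α j * approxSum α j ≤ relSize α (j + 1) * approxSum α (j + 1) := by
  filter_upwards [eventually_logLogLog_succ_le, tendsto_logLogLog_sq.eventually_gt_atTop 0,
    (tendsto_add_atTop_nat 1).eventually (tendsto_logLogLog_sq.eventually_gt_atTop 0),
    eventually_ge_atTop 5] with j h1 h2 h3 hj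
  have hj' : (5 : ℝ) ≤ j := by exact_mod_cast hj
  have hj0 : (0 : ℝ) < 1 / j := by positivity
  have h4 : relSize α j ≤ (1 + 1 / (j : ℝ)) ^ 2 * relSize α (j + 1) := by
    rw [relSize, relSize, mul_add]
    refine add_le_add ?_ ?_
    · push_cast at h3 ⊢
      rw [mul_div_assoc', div_le_div_iff₀ h2 h3]
      nlinarith [mul_le_mul_of_nonneg_left h1 hα]
    · rw [mul_one_div, div_le_div_iff₀ (by positivity) (by positivity), one_mul]
      refine Real.sqrt_le_iff.2 ⟨by positivity, ?_⟩
      rw [mul_pow, Real.sq_sqrt (by positivity)]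
      have h5 : (1 + 1 / (j : ℝ)) * (j + 1) ≥ j + 2 := by
        have : (1 + 1 / (j : ℝ)) * (j + 1) = j + 2 + 1 / j := by field_simp; ring
        linarith
      have h6 : (1 + 1 / (j : ℝ)) ≤ ((1 + 1 / (j : ℝ)) ^ 2) ^ 2 := by
        rw [← pow_mul]
        exact le_self_pow₀ (by linarith) (by norm_num)
      push_cast
      nlinarith
  have h7 : (1 + 1 / (j : ℝ)) ^ 2 ≤ Real.exp (relSize α j) := by
    have h8 : 2 * (1 / (j : ℝ)) ≤ relSize α j := by
      refine le_trans ?_ (inv_sqrt_le_relSize hα j)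
      rw [mul_one_div, div_le_div_iff₀ (by positivity) (by positivity), one_mul]
      have h9 : 2 * √((j : ℝ) + 1) = √(4 * (j + 1)) := by
        rw [Real.sqrt_mul (by norm_num), show (4 : ℝ) = 2 ^ 2 by norm_num,
          Real.sqrt_sq (by norm_num)]
      rw [h9]
      exact Real.sqrt_le_iff.2 ⟨by positivity, by nlinarith⟩
    calc (1 + 1 / (j : ℝ)) ^ 2 ≤ Real.exp (1 / j) ^ 2 := by
          gcongr
          have := Real.add_one_le_exp (1 / (j : ℝ))
          linarith
      _ = Real.exp (2 * (1 / j)) := by rw [← Real.exp_nat_mul]; norm_num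
      _ ≤ _ := Real.exp_le_exp.2 h8
  rw [approxSum_succ]
  have h9 := approxSum_pos (α := α) j
  have h10 := relSize_pos hα (j + 1)
  calc _ ≤ ((1 + 1 / (j : ℝ)) ^ 2 * relSize α (j + 1)) * approxSum α j := by gcongr
    _ = relSize α (j + 1) * (approxSum α j * (1 + 1 / (j : ℝ)) ^ 2) := by ring
    _ ≤ _ := by gcongr

theorem eventually_insDigit_le (hα : 0 ≤ α) :
    ∀ᶠ j : ℕ in atTop, ∀ i ≤ j, insDigit m α i ≤ insDigit m α j := by
  obtain ⟨N, hN⟩ := eventually_atTop.1 (eventually_relSize_mul_approxSum_mono hα)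
  have hmono : ∀ i j, N ≤ i → i ≤ j → insDigit m α i ≤ insDigit m α j := by
    intro i j hi hij
    induction j, hij using Nat.le_induction with
    | base => exact le_rfl
    | succ j hij ih =>
      exact ih.trans (Nat.add_le_add_left (Nat.ceil_le_ceil (hN j (hi.trans hij))) m)
  set M := (Finset.range N).sup (insDigit m α)
  filter_upwards [(tendsto_relSize_mul_approxSum hα).eventually_ge_atTop (M : ℝ)] with j hM i hi
  rcases lt_or_ge i N with hiN | hiN
  · refine (Finset.le_sup (Finset.mem_range.2 hiN)).trans ?_
    have : M ≤ ⌈relSize α j * approxSum α j⌉₊ := by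
      exact_mod_cast hM.trans (Nat.le_ceil _)
    exact this.trans (Nat.le_add_left _ _)
  · exact hmono i j hiN hi

theorem subExp_approxSum (hα : 0 ≤ α) : SubExp (approxSum α) := by
  intro δ hδ
  obtain ⟨N, hN⟩ := eventually_atTop.1 (tendsto_relSize (α := α) |>.eventually_le_const hδ)
  refine ⟨approxSum α N, approxSum_pos N, fun n => ?_⟩
  rw [approxSum, approxSum, ← Real.exp_add]
  refine Real.exp_le_exp.2 ?_
  rcases le_total n N with hn | hn
  · have := Finset.sum_le_sum_of_subset_of_nonneg (Finset.range_mono hn)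
      fun i _ _ => (relSize_pos hα i).le
    have : 0 ≤ δ * n := by positivity
    linarith
  · induction n, hn using Nat.le_induction with
    | base => exact le_add_of_nonneg_right (by positivity)
    | succ n hn ih =>
      rw [Finset.sum_range_succ]
      have := hN n hn
      push_cast
      linarith

theorem subExp_insDigit (hα : 0 ≤ α) : SubExp fun j => insDigit m α j := by
  obtain ⟨B, hB⟩ := (tendsto_relSize (α := α)).bddAbove_range
  have h1 : SubExp fun j => (m : ℝ) + 1 + B * approxSum α j := by
    refine (SubExp.const _).add ((SubExp.const B).mul (subExp_approxSum hα) (fun _ => ?_)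
      fun j => (approxSum_pos j).le)
    exact (relSize_pos hα 0).le.trans (hB (mem_range_self 0))
  refine h1.mono fun j => ?_
  have h2 := Nat.ceil_lt_add_one (mul_pos (relSize_pos hα j) (approxSum_pos (α := α) j)).le
  have h3 : relSize α j * approxSum α j ≤ B * approxSum α j :=
    mul_le_mul_of_nonneg_right (hB (mem_range_self j)) (approxSum_pos j).le
  rw [insDigit]
  push_cast
  linarith

theorem tendsto_approxSum (hα : 0 ≤ α) : Tendsto (approxSum α) atTop atTop :=
  tendsto_atTop_mono (exp_sqrt_le_approxSum hα)
    (Real.tendsto_exp_atTop.comp (Real.tendsto_sqrt_atTop.comp tendsto_natCast_atTop_atTop))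

theorem tendsto_sum_insDigit_div (hα : 0 ≤ α) :
    Tendsto (fun j : ℕ => (∑ i ∈ Finset.range j, (insDigit m α i : ℝ)) / approxSum α j)
      atTop (𝓝 1) := by
  set Δ : ℕ → ℝ := fun j => approxSum α (j + 1) - approxSum α j with hΔ
  have hΔeq : ∀ j, Δ j = approxSum α j * (Real.exp (relSize α j) - 1) := fun j => by
    simp only [hΔ, approxSum_succ]; ring
  have hΔpos : ∀ j, 0 < Δ j := fun j => by
    rw [hΔeq]
    exact mul_pos (approxSum_pos j) (sub_pos.2 (Real.one_lt_exp_iff.2 (relSize_pos hα j)))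
  have hsum : ∀ j, ∑ i ∈ Finset.range j, Δ i = approxSum α j - 1 := fun j => by
    simp only [hΔ]
    rw [Finset.sum_range_sub]
    simp [approxSum]
  have h1 : Tendsto (fun j => (relSize α j)⁻¹ * (Real.exp (relSize α j) - 1)) atTop (𝓝 1) := by
    have h2 := (Real.hasDerivAt_exp 0).tendsto_slope_zero
    have h3 : Tendsto (relSize α) atTop (𝓝[≠] 0) := tendsto_nhdsWithin_iff.2
      ⟨tendsto_relSize, Eventually.of_forall fun j => (relSize_pos hα j).ne'⟩
    simpa [Function.comp_def] using h2.comp h3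
  have h2 : Tendsto (fun j => (insDigit m α j : ℝ) / Δ j) atTop (𝓝 1) := by
    have h3 := (tendsto_insDigit_div (m := m) hα).div h1 one_ne_zero
    rw [div_one] at h3
    refine h3.congr fun j => ?_
    have h4 := (relSize_pos hα j).ne'
    simp only [Pi.div_apply]
    rw [hΔeq, div_div]
    congr 1
    field_simp
  have h3 : (fun j => (insDigit m α j : ℝ) - Δ j) =o[atTop] Δ := by
    rw [Asymptotics.isLittleO_iff_tendsto fun j hj => absurd hj (hΔpos j).ne']
    have := h2.sub_const 1
    rw [sub_self] at this
    refine this.congr fun j => ?_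
    rw [sub_div, div_self (hΔpos j).ne']
  have h4 := h3.sum_range (fun j => (hΔpos j).le) (by
    simp_rw [hsum]
    exact tendsto_atTop_add_const_right _ (-1) (tendsto_approxSum hα))
  simp_rw [Finset.sum_sub_distrib, hsum] at h4
  have h5 : (fun j => approxSum α j - 1) =O[atTop] approxSum α := by
    refine Asymptotics.IsBigO.of_bound 1 ?_
    filter_upwards [(tendsto_approxSum hα).eventually_ge_atTop 1] with j hj
    rw [Real.norm_of_nonneg (by linarith), Real.norm_of_nonneg (by linarith)]
    linarith
  have h6 := ((h4.trans_isBigO h5).tendsto_div_nhds_zero.add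
    ((tendsto_approxSum hα).const_div_atTop (-1))).add_const 1
  simp only [zero_add] at h6
  refine h6.congr fun j => ?_
  have := (approxSum_pos (α := α) j).ne'
  field_simp
  ring

end ThetaExpansion

namespace ThetaExpansion

open Filter Topology Set

variable {θ α : ℝ} {m : ℕ}

theorem filter_isSquare_range {j n : ℕ} (h1 : j ^ 2 < n) (h2 : n ≤ (j + 1) ^ 2) :
    (Finset.range n).filter IsSquare = (Finset.range (j + 1)).image fun i => i * i := by
  ext k
  simp only [Finset.mem_filter, Finset.mem_range, Finset.mem_image]
  constructor
  · rintro ⟨hk, r, rfl⟩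
    exact ⟨r, by nlinarith, rfl⟩
  · rintro ⟨r, hr, rfl⟩
    exact ⟨by nlinarith, r, rfl⟩

theorem digitMax_eq_sup (x : ℝ) (n : ℕ) :
    digitMax θ x n = (Finset.range n).sup (digits θ x) := by
  refine le_antisymm (Finset.sup_le fun k hk => ?_) (Finset.sup_le fun k hk => ?_)
  · obtain ⟨h1, h2⟩ := Finset.mem_Icc.1 hk
    have h3 : digit θ x k = digits θ x (k - 1) := by rw [digits, Nat.sub_add_cancel h1]
    rw [h3]
    exact Finset.le_sup (f := digits θ x) (Finset.mem_range.2 (by omega))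
  · have h1 := Finset.mem_range.1 hk
    exact Finset.le_sup (f := digit θ x) (Finset.mem_Icc.2 ⟨by omega, by omega⟩)

theorem digitSum_eq_sum (x : ℝ) (n : ℕ) :
    digitSum θ x n = ∑ k ∈ Finset.range n, digits θ x k := by
  have h1 : Finset.Icc 1 n = (Finset.range n).image (· + 1) := by
    ext k
    simp only [Finset.mem_Icc, Finset.mem_image, Finset.mem_range]
    exact ⟨fun hk => ⟨k - 1, by omega, by omega⟩, by rintro ⟨i, hi, rfl⟩; omega⟩
  rw [digitSum, h1, Finset.sum_image fun a _ b _ hab => Nat.succ_injective hab]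
  rfl

/-- A bound for the digits of points of `insertSet` at nonsquare positions below `(j + 1)²`. -/
def freeBound (m j : ℕ) : ℕ := 24 * m * (j + 1) ^ 4

theorem digits_le_freeBound {a : ℕ → ℕ} {x : ℝ} (hx : x ∈ insertSet θ m a) {j k : ℕ}
    (hk : k < (j + 1) ^ 2) (hsq : ¬ IsSquare k) : digits θ x k ≤ freeBound m j := by
  refine ((hx.2 k).2 hsq).trans ?_
  have h2 : k + 1 ≤ (j + 1) ^ 2 := hk
  have h3 : k + 2 ≤ 2 * (j + 1) ^ 2 := by nlinarith
  calc 4 * m * ((k + 1) * (k + 2)) ≤ 4 * m * ((j + 1) ^ 2 * (2 * (j + 1) ^ 2)) := by gcongr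
    _ = 8 * m * (j + 1) ^ 4 := by ring
    _ ≤ _ := by
      unfold freeBound
      gcongr
      norm_num

theorem digitMax_eq {a : ℕ → ℕ} {x : ℝ} (hx : x ∈ insertSet θ m a) {j n : ℕ}
    (h1 : j ^ 2 < n) (h2 : n ≤ (j + 1) ^ 2) (ha : ∀ i ≤ j, a i ≤ a j)
    (hfree : freeBound m j ≤ a j) : digitMax θ x n = a j := by
  rw [digitMax_eq_sup]
  refine le_antisymm (Finset.sup_le fun k hk => ?_) ?_
  · have hk' := Finset.mem_range.1 hk
    by_cases hsq : IsSquare k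
    · rw [(hx.2 k).1 hsq]
      refine ha _ (Nat.lt_succ_iff.1 (Nat.sqrt_lt'.2 (hk'.trans_le h2)))
    · exact (digits_le_freeBound hx (hk'.trans_le h2) hsq).trans hfree
  · have h3 : digits θ x (j ^ 2) = a j := by
      rw [(hx.2 _).1 (IsSquare.sq j), Nat.sqrt_eq']
    rw [← h3]
    exact Finset.le_sup (Finset.mem_range.2 h1)

theorem digitSum_bounds {a : ℕ → ℕ} {x : ℝ} (hx : x ∈ insertSet θ m a) {j n : ℕ}
    (h1 : j ^ 2 < n) (h2 : n ≤ (j + 1) ^ 2) :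
    ∑ i ∈ Finset.range (j + 1), a i ≤ digitSum θ x n ∧
      digitSum θ x n ≤ ∑ i ∈ Finset.range (j + 1), a i + (j + 1) ^ 2 * freeBound m j := by
  have h3 : ∑ k ∈ (Finset.range n).filter IsSquare, digits θ x k
      = ∑ i ∈ Finset.range (j + 1), a i := by
    rw [filter_isSquare_range h1 h2, Finset.sum_image fun r _ s _ hrs => by
      exact Nat.mul_self_inj.1 hrs]
    refine Finset.sum_congr rfl fun i _ => ?_
    rw [(hx.2 _).1 ⟨i, rfl⟩, Nat.sqrt_eq]
  rw [digitSum_eq_sum, ← Finset.sum_filter_add_sum_filter_not (Finset.range n) IsSquare, h3]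
  refine ⟨Nat.le_add_right _ _, Nat.add_le_add_left ?_ _⟩
  calc _ ≤ ((Finset.range n).filter fun k => ¬ IsSquare k).card • freeBound m j :=
        Finset.sum_le_card_nsmul _ _ _ fun k hk => by
          obtain ⟨hk, hsq⟩ := Finset.mem_filter.1 hk
          exact digits_le_freeBound hx ((Finset.mem_range.1 hk).trans_le h2) hsq
    _ ≤ _ := by
        rw [smul_eq_mul]
        gcongr
        exact (Finset.card_filter_le _ _).trans (by simpa using h2)

theorem tendsto_quotient_of_mem_insertSet (hα : 0 ≤ α) {x : ℝ}
    (hx : x ∈ insertSet θ m (insDigit m α)) :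
    Tendsto (fun n : ℕ => (digitMax θ x n : ℝ) * Real.log n * Real.log (Real.log n) /
        ((digitSum θ x n : ℝ) - (digitMax θ x n : ℝ))) atTop (𝓝 α) := by
  set a := insDigit m α with ha
  set y : ℕ → ℝ := fun j => relSize α j * approxSum α j with hy
  set sumA : ℕ → ℝ := fun j => ∑ i ∈ Finset.range j, (a i : ℝ) with hsum
  set free : ℕ → ℝ := fun j => ((j : ℝ) + 1) ^ 2 * freeBound m j with hfree
  have hy0 : ∀ j, 0 < y j := fun j => mul_pos (relSize_pos hα j) (approxSum_pos j)
  have hE0 : ∀ j, 0 < approxSum α j := fun j => approxSum_pos j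
  have t_a : Tendsto (fun j => (a j : ℝ) / y j) atTop (𝓝 1) := tendsto_insDigit_div hα
  have t_sum : Tendsto (fun j => sumA j / approxSum α j) atTop (𝓝 1) := tendsto_sum_insDigit_div hα
  have t_free : Tendsto (fun j => free j / y j) atTop (𝓝 0) := by
    have := (tendsto_pow_div_relSize_mul hα 6).const_mul (24 * m : ℝ)
    rw [mul_zero] at this
    refine this.congr fun j => ?_
    simp only [hfree, hy, freeBound]
    push_cast
    ring
  have t_freeE : Tendsto (fun j => free j / approxSum α j) atTop (𝓝 0) := by
    have := t_free.mul (tendsto_relSize (α := α))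
    rw [zero_mul] at this
    refine this.congr fun j => ?_
    have h1 := (relSize_pos hα j).ne'
    have h2 := (hE0 j).ne'
    simp only [hy]
    field_simp
  have t_main : Tendsto (fun j : ℕ => (a j : ℝ) / y j * (relSize α j * logLogLog ((j : ℝ) ^ 2)))
      atTop (𝓝 α) := by
    simpa using t_a.mul (tendsto_relSize_mul α)
  have t_low : Tendsto (fun j : ℕ => (a j : ℝ) * logLogLog ((j : ℝ) ^ 2) / (sumA j + free j))
      atTop (𝓝 α) := by
    have h1 := t_main.div (t_sum.add t_freeE) (by norm_num)
    rw [add_zero, div_one] at h1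
    refine h1.congr fun j => ?_
    have h2 := (relSize_pos hα j).ne'
    have h3 := (hE0 j).ne'
    simp only [Pi.div_apply, hy]
    rw [← add_div]
    field_simp
  have t_up : Tendsto (fun j : ℕ => (a j : ℝ) * ((1 + 1 / (j : ℝ)) ^ 2
      * logLogLog ((j : ℝ) ^ 2)) / sumA j) atTop (𝓝 α) := by
    have h0 : Tendsto (fun j : ℕ => (1 + 1 / (j : ℝ)) ^ 2) atTop (𝓝 1) := by
      simpa using (tendsto_one_div_atTop_nhds_zero_nat (𝕜 := ℝ)).const_add 1 |>.pow 2
    have h1 := (h0.mul t_main).div t_sum one_ne_zero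
    rw [div_one, one_mul] at h1
    refine h1.congr fun j => ?_
    have h2 := (relSize_pos hα j).ne'
    have h3 := (hE0 j).ne'
    simp only [Pi.div_apply, hy]
    field_simp
  have hj : Tendsto (fun n : ℕ => (n - 1).sqrt) atTop atTop := by
    refine tendsto_atTop.2 fun b => ?_
    filter_upwards [eventually_ge_atTop (b * b + 1)] with n hn
    exact Nat.le_sqrt.2 (by omega)
  have ev_free : ∀ᶠ j : ℕ in atTop, freeBound m j ≤ a j := by
    have h1 := (t_a.sub t_free).eventually_const_lt (show (0 : ℝ) < 1 - 0 by norm_num)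
    filter_upwards [h1] with j hj
    rw [← sub_div] at hj
    have h2 := (div_pos_iff_of_pos_right (hy0 j)).1 hj
    have h3 : (freeBound m j : ℝ) ≤ free j := by
      refine le_mul_of_one_le_left (by positivity) ?_
      exact one_le_pow₀ (by linarith [Nat.cast_nonneg (α := ℝ) j])
    exact_mod_cast (h3.trans (sub_pos.1 h2).le)
  have ev_sum : ∀ᶠ j : ℕ in atTop, 0 < sumA j := by
    filter_upwards [t_sum.eventually_const_lt (show (0 : ℝ) < 1 by norm_num)] with j hj
    exact (div_pos_iff_of_pos_right (hE0 j)).1 hj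
  have ev : ∀ᶠ j : ℕ in atTop, ∀ n : ℕ, j ^ 2 < n → n ≤ (j + 1) ^ 2 →
      (a j : ℝ) * logLogLog ((j : ℝ) ^ 2) / (sumA j + free j) ≤
        (digitMax θ x n : ℝ) * Real.log n * Real.log (Real.log n) /
          ((digitSum θ x n : ℝ) - (digitMax θ x n : ℝ)) ∧
      (digitMax θ x n : ℝ) * Real.log n * Real.log (Real.log n) /
          ((digitSum θ x n : ℝ) - (digitMax θ x n : ℝ)) ≤
        (a j : ℝ) * ((1 + 1 / (j : ℝ)) ^ 2 * logLogLog ((j : ℝ) ^ 2)) / sumA j := by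
    filter_upwards [ev_free, ev_sum, eventually_insDigit_le (m := m) hα,
      eventually_logLogLog_succ_le, eventually_ge_atTop 2] with j e1 e2 e3 e4 e5 n hn1 hn2
    rw [digitMax_eq hx hn1 hn2 e3 e1]
    obtain ⟨s1, s2⟩ := digitSum_bounds hx hn1 hn2
    have s1' : sumA j ≤ (digitSum θ x n : ℝ) - a j := by
      have : (∑ i ∈ Finset.range (j + 1), (a i : ℝ)) ≤ digitSum θ x n := by exact_mod_cast s1
      rw [Finset.sum_range_succ] at this
      linarith
    have s2' : (digitSum θ x n : ℝ) - a j ≤ sumA j + free j := by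
      have : (digitSum θ x n : ℝ) ≤ (∑ i ∈ Finset.range (j + 1), (a i : ℝ)) + free j := by
        simp only [hfree]
        exact_mod_cast s2
      rw [Finset.sum_range_succ] at this
      linarith
    have hj2 : (2 : ℝ) ≤ j := by exact_mod_cast e5
    have hn1' : (j : ℝ) ^ 2 ≤ n := by exact_mod_cast hn1.le
    have hn2' : (n : ℝ) ≤ ((j : ℝ) + 1) ^ 2 := by exact_mod_cast hn2
    have hexp : Real.exp 1 ≤ (j : ℝ) ^ 2 := by nlinarith [Real.exp_one_lt_d9]
    have l1 := logLogLog_mono hexp hn1'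
    have l2 := (logLogLog_mono (hexp.trans hn1') hn2').trans e4
    have l0 := logLogLog_sq_nonneg j
    have ha0 : (0 : ℝ) ≤ a j := Nat.cast_nonneg _
    rw [mul_assoc, show Real.log n * Real.log (Real.log n) = logLogLog n from rfl]
    constructor
    · exact div_le_div₀ (mul_nonneg ha0 (l0.trans l1)) (by gcongr) (e2.trans_le s1') s2'
    · exact div_le_div₀ (mul_nonneg ha0 (by positivity)) (by gcongr) e2 s1'
  have hrange : ∀ᶠ n : ℕ in atTop, (n - 1).sqrt ^ 2 < n ∧ n ≤ ((n - 1).sqrt + 1) ^ 2 := by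
    filter_upwards [eventually_ge_atTop 1] with n hn
    have h1 := Nat.sqrt_le' (n - 1)
    have h2 := Nat.lt_succ_sqrt' (n - 1)
    rw [Nat.succ_eq_add_one] at h2
    omega
  refine tendsto_of_tendsto_of_tendsto_of_le_of_le' (t_low.comp hj) (t_up.comp hj) ?_ ?_
  · filter_upwards [hj.eventually ev, hrange] with n h1 h2
    exact (h1 n h2.1 h2.2).1
  · filter_upwards [hj.eventually ev, hrange] with n h1 h2
    exact (h1 n h2.1 h2.2).2

theorem one_le_dimH_levelSet (h : Param θ m) (hα : 0 ≤ α) : 1 ≤ dimH (levelSet θ α) := by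
  have h1 := one_le_dimH_insertSet h (a := insDigit m α) (fun j => Nat.le_add_right _ _)
    (subExp_insDigit hα)
  have h2 : insertSet θ m (insDigit m α) ⊆ levelSet θ α ∪ range ((↑) : ℚ → ℝ) := by
    intro x hx
    by_cases hirr : Irrational x
    · exact Or.inl ⟨hx.1.1, hirr, hx.1.2, tendsto_quotient_of_mem_insertSet hα hx⟩
    · exact Or.inr (not_not.1 hirr)
  have h3 := h1.trans (dimH_mono h2)
  rwa [dimH_union, (countable_range _).dimH_zero, max_eq_left (zero_le)] at h3

end ThetaExpansion

theorem theorem1 (θ : ℝ) (hθ : θ ∈ Set.Ioo (0 : ℝ) 1) (hirr : Irrational θ)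
    (m : ℕ) (hm : 0 < m) (hsq : ¬ IsSquare m) (hθm : θ ^ 2 = 1 / (m : ℝ))
    (α : ℝ) (hα : 0 ≤ α) :
    dimH (ThetaExpansion.levelSet θ α) = 1 := by
  have hm' : (m : ℝ) ≠ 0 := by exact_mod_cast hm.ne'
  have h : ThetaExpansion.Param θ m := ⟨hθ.1, hθ.2, by rw [hθm]; field_simp⟩
  refine le_antisymm ?_ (ThetaExpansion.one_le_dimH_levelSet h hα)
  exact (dimH_mono (Set.subset_univ _)).trans_eq Real.dimH_univ
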